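/- Let $(M,\omega)$ be a symplectic manifold of dimension $2n$ (without boundary, Hausdorff, second countable), let $L\subset M$ be a compact Lagrangian submanifold, let $U\subset M$ be open, and let $H:[0,1]\times M\to\mathbb R$ be a smooth compactly supported Hamiltonian with Hamiltonian flow $\phi_H^t$. Assume $L\cap U\neq\emptyset$ and $U\cap\phi_H^1(L)=\emptyset$. Let $(e,J_0)$ be a $(U,L)$-adapted pair, that is: for some $r>0$, $e:B^{2n}(r)\to M$ is a symplectic embedding of the closed ball of radius $r$ in $(\mathbb C^n,\sum_j dq_j\wedge dp_j)$, $z_j=q_j+ip_j$, such that $e^{-1}(L)=B^{2n}(r)\cap\mathbb R^n$ and $e(B^{2n}(r))\subset U$; and $J_0$ is an almost complex structure on $M$ compatible with $\omega$ (i.e. $g_{J_0}=\omega(\cdot,J_0\cdot)$ is a Riemannian metric) with $J_0=e_*j$ on $e(B^{2n}(r))$, where $j$ is the standard complex structure of $\mathbb C^n$. Put $p=e(0)$. Let $v:\mathbb R\times[0,1]\to M$ be a smooth map satisfying $$\frac{\partial v}{\partial\tau}+J_0\frac{\partial v}{\partial t}=0,\qquad v(\tau,0)\in L,\quad v(\tau,1)\in\phi_H^1(L)\quad(\tau\in\mathbb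 R),$$ with finite energy $\frac12\int_{\mathbb R\times[0,1]}\big(|\partial_\tau v|_{J_0}^2+|\partial_t v|_{J_0}^2\big)\,d\tau\,dt<\infty$ and with $v(0,0)=p$. Then $v^*\omega$ is integrable over $\mathbb R\times[0,1]$ and $$\int_{\mathbb R\times[0,1]} v^*\omega\;\ge\;\frac{\pi r^2}{2}.$$ -/

import Mathlib

open Set MeasureTheory
open scoped Manifold ContDiff

noncomputable section

namespace Strip

/-- The model space `ℝ^{2n}` of a `2n`-dimensional manifold. -/
abbrev Model (n : ℕ) : Type := EuclideanSpace ℝ (Fin (2 * n))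

/-- `ℂ^n`, regarded as a real normed space. -/
abbrev Cn (n : ℕ) : Type := EuclideanSpace ℂ (Fin n)

section Manifold

variable (n : ℕ) (M : Type*) [TopologicalSpace M] [ChartedSpace (Model n) M]

/-- A (not necessarily continuous) differential two-form on `M`. -/
abbrev TwoForm : Type _ := ∀ x : M, TangentSpace (𝓡 (2 * n)) x [⋀^Fin 2]→L[ℝ] ℝ

/-- A (not necessarily continuous) field of endomorphisms of the tangent spaces of `M`. -/
abbrev EndField : Type _ :=
  ∀ x : M, TangentSpace (𝓡 (2 * n)) x →L[ℝ] TangentSpace (𝓡 (2 * n)) x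

variable {n M}

/-- The expression of a two-form in the preferred chart at `x₀`, i.e. its pullback by the inverse
of the chart; it is meaningful on the target of the chart. -/
def TwoForm.inChart (Ω : TwoForm n M) (x₀ : M) (y : Model n) : Model n [⋀^Fin 2]→L[ℝ] ℝ :=
  (Ω ((extChartAt (𝓡 (2 * n)) x₀).symm y)).compContinuousLinearMap
    (mfderiv 𝓘(ℝ, Model n) (𝓡 (2 * n)) (extChartAt (𝓡 (2 * n)) x₀).symm y)

/-- `Ω` is a symplectic form: a smooth, closed and nondegenerate two-form. -/
structure IsSymplecticForm (Ω : TwoForm n M) : Prop where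
  smooth : ∀ x₀ : M, ContDiffOn ℝ ∞ (Ω.inChart x₀) (extChartAt (𝓡 (2 * n)) x₀).target
  closed : ∀ x₀ : M, ∀ y ∈ (extChartAt (𝓡 (2 * n)) x₀).target, extDeriv (Ω.inChart x₀) y = 0
  nondegenerate : ∀ (x : M) (u : TangentSpace (𝓡 (2 * n)) x), (∀ w, Ω x ![u, w] = 0) → u = 0

/-- `J` is an almost complex structure compatible with `Ω`: it is smooth, `J² = -1`, and
`Ω(·, J ·)` is a Riemannian metric. -/
structure IsCompatible (Ω : TwoForm n M) [IsManifold (𝓡 (2 * n)) ∞ M] (J : EndField n M) :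
    Prop where
  smooth : ContMDiff (𝓡 (2 * n)) ((𝓡 (2 * n)).prod 𝓘(ℝ, Model n →L[ℝ] Model n)) ∞
    (fun x => Bundle.TotalSpace.mk' (Model n →L[ℝ] Model n)
      (E := fun x : M => TangentSpace (𝓡 (2 * n)) x →L[ℝ] TangentSpace (𝓡 (2 * n)) x) x (J x))
  sq : ∀ (x : M) (u : TangentSpace (𝓡 (2 * n)) x), J x (J x u) = -u
  symm : ∀ (x : M) (u w : TangentSpace (𝓡 (2 * n)) x), Ω x ![u, J x w] = Ω x ![w, J x u]
  pos : ∀ (x : M) (u : TangentSpace (𝓡 (2 * n)) x), u ≠ 0 → 0 < Ω x ![u, J x u]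

/-- `L` is an (embedded) Lagrangian submanifold of `(M, Ω)`: around each of its points there is a
chart of the maximal smooth atlas in which `L` is an `n`-dimensional linear subspace `S`, and `Ω`
vanishes on the tangent spaces of `L` (the vectors that the chart maps into `S`). -/
def IsLagrangian (Ω : TwoForm n M) (L : Set M) : Prop :=
  ∀ q ∈ L, ∃ φ ∈ IsManifold.maximalAtlas (𝓡 (2 * n)) ∞ M, q ∈ φ.source ∧
    ∃ S : Submodule ℝ (Model n), Module.finrank ℝ S = n ∧
      (∀ x ∈ φ.source, x ∈ L ↔ φ x ∈ S) ∧
      ∀ x ∈ φ.source ∩ L, ∀ u w : TangentSpace (𝓡 (2 * n)) x,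
        (mfderiv (𝓡 (2 * n)) 𝓘(ℝ, Model n) φ x u : Model n) ∈ S →
        (mfderiv (𝓡 (2 * n)) 𝓘(ℝ, Model n) φ x w : Model n) ∈ S → Ω x ![u, w] = 0

/-- A smooth, compactly supported, time-dependent Hamiltonian on `[0,1] × M`
(only the values of `H t` for `t ∈ [0,1]` matter). -/
structure IsHamiltonian (H : ℝ → M → ℝ) : Prop where
  smooth : ContMDiffOn (𝓘(ℝ, ℝ).prod (𝓡 (2 * n))) 𝓘(ℝ, ℝ) ∞
    (fun q : ℝ × M => H q.1 q.2) (Icc (0 : ℝ) 1 ×ˢ univ)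
  compactSupport : ∃ K : Set M, IsCompact K ∧ ∀ t ∈ Icc (0 : ℝ) 1, ∀ x ∉ K, H t x = 0

/-- `X` is the value at `x` of the Hamiltonian vector field of `f`: `Ω(X, ·) = df`. -/
def IsHamiltonianVector (Ω : TwoForm n M) (f : M → ℝ) (x : M)
    (X : TangentSpace (𝓡 (2 * n)) x) : Prop :=
  ∀ w : TangentSpace (𝓡 (2 * n)) x, Ω x ![X, w] = mfderiv (𝓡 (2 * n)) 𝓘(ℝ, ℝ) f x w

/-- `φ t`, `t ∈ [0,1]`, is the flow `φ_H^t` of Hamilton's equation `ż = X_{H_t}(z)`. -/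
structure IsHamiltonianFlow (Ω : TwoForm n M) (H : ℝ → M → ℝ) (φ : ℝ → M → M) : Prop where
  zero : ∀ x, φ 0 x = x
  differentiable : ∀ x, MDifferentiableOn 𝓘(ℝ, ℝ) (𝓡 (2 * n)) (fun t => φ t x) (Icc (0 : ℝ) 1)
  deriv : ∀ x, ∀ t ∈ Icc (0 : ℝ) 1, IsHamiltonianVector Ω (H t) (φ t x)
    (mfderivWithin 𝓘(ℝ, ℝ) (𝓡 (2 * n)) (fun s => φ s x) (Icc (0 : ℝ) 1) t (1 : ℝ))

/-- The standard symplectic form `∑ dq_j ∧ dp_j` on `ℂ^n`, `z_j = q_j + i p_j`. -/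
def stdForm (u w : Cn n) : ℝ := ∑ j, ((u j).re * (w j).im - (u j).im * (w j).re)

/-- The derivative of `e : B(r) → M` at a point of the closed ball `B(r)` of `ℂ^n`. -/
def ballDeriv (e : Cn n → M) (r : ℝ) (z : Cn n) : Cn n →L[ℝ] TangentSpace (𝓡 (2 * n)) (e z) :=
  mfderivWithin 𝓘(ℝ, Cn n) (𝓡 (2 * n)) e (Metric.closedBall 0 r) z

/-- `e` is a symplectic embedding of the closed ball of radius `r` in `ℂ^n` into `(M, Ω)`.
(An injective smooth map of the compact ball with `e^* Ω = Ω₀` is an embedding.) -/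
structure IsSymplecticEmbedding (Ω : TwoForm n M) (e : Cn n → M) (r : ℝ) : Prop where
  smooth : ContMDiffOn 𝓘(ℝ, Cn n) (𝓡 (2 * n)) ∞ e (Metric.closedBall 0 r)
  injOn : InjOn e (Metric.closedBall 0 r)
  pullback : ∀ z ∈ Metric.closedBall (0 : Cn n) r, ∀ u w : Cn n,
    Ω (e z) ![ballDeriv e r z u, ballDeriv e r z w] = stdForm u w

/-- `(e, J)` is a `(U, L)`-adapted pair: `e` is a symplectic embedding of the closed ball `B(r)`
with `e⁻¹(L) = B(r) ∩ ℝ^n` and `e(B(r)) ⊆ U`, and `J` is a compatible almost complex structure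
with `J = e_* j` on `e(B(r))`. -/
structure IsAdaptedPair (Ω : TwoForm n M) [IsManifold (𝓡 (2 * n)) ∞ M] (U L : Set M)
    (e : Cn n → M) (r : ℝ) (J : EndField n M) : Prop where
  embedding : IsSymplecticEmbedding Ω e r
  preimage : ∀ z ∈ Metric.closedBall (0 : Cn n) r, e z ∈ L ↔ ∀ j, (z j).im = 0
  subset : e '' Metric.closedBall 0 r ⊆ U
  compatible : IsCompatible Ω J
  pushforward : ∀ z ∈ Metric.closedBall (0 : Cn n) r, ∀ u : Cn n,
    J (e z) (ballDeriv e r z u) = ballDeriv e r z (Complex.I • u)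

/-- The strip `ℝ × [0,1]`, with coordinates `(τ, t)`. -/
def strip : Set (ℝ × ℝ) := univ ×ˢ Icc (0 : ℝ) 1

/-- `∂v/∂τ`. -/
def dTau (v : ℝ × ℝ → M) (z : ℝ × ℝ) : TangentSpace (𝓡 (2 * n)) (v z) :=
  mfderivWithin 𝓘(ℝ, ℝ × ℝ) (𝓡 (2 * n)) v strip z ((1, 0) : ℝ × ℝ)

/-- `∂v/∂t`. -/
def dT (v : ℝ × ℝ → M) (z : ℝ × ℝ) : TangentSpace (𝓡 (2 * n)) (v z) :=
  mfderivWithin 𝓘(ℝ, ℝ × ℝ) (𝓡 (2 * n)) v strip z ((0, 1) : ℝ × ℝ)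

/-- `v : ℝ × [0,1] → M` is a smooth `J`-holomorphic strip with boundary on `L₀` (at `t = 0`) and
`L₁` (at `t = 1`). -/
structure IsHolomorphicStrip (J : EndField n M) (L₀ L₁ : Set M) (v : ℝ × ℝ → M) : Prop where
  smooth : ContMDiffOn 𝓘(ℝ, ℝ × ℝ) (𝓡 (2 * n)) ∞ v strip
  cauchyRiemann : ∀ z ∈ strip, dTau (n := n) v z + J (v z) (dT v z) = 0
  bottom : ∀ τ : ℝ, v (τ, 0) ∈ L₀
  top : ∀ τ : ℝ, v (τ, 1) ∈ L₁

/-- The energy `½ ∫ |∂v/∂τ|_J² + |∂v/∂t|_J²`, where `|u|_J² = Ω(u, J u)`. -/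
def energy (Ω : TwoForm n M) (J : EndField n M) (v : ℝ × ℝ → M) : ENNReal :=
  2⁻¹ * ∫⁻ z in strip, ENNReal.ofReal
    (Ω (v z) ![dTau v z, J (v z) (dTau v z)] + Ω (v z) ![dT v z, J (v z) (dT v z)])

/-- The density of `v^* Ω` with respect to `dτ ∧ dt`. -/
def areaDensity (Ω : TwoForm n M) (v : ℝ × ℝ → M) (z : ℝ × ℝ) : ℝ :=
  Ω (v z) ![dTau v z, dT v z]

end Manifold

end Strip

end

namespace Strip

open Filter Topology

/-! ### Holomorphic pieces of the strip in the flat ball, and their first derivatives -/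

section

/-! Let `D` be the part of the strip that `v` maps into the open Darboux ball. There `w = e⁻¹ ∘ v`
is an ordinary holomorphic map to `ℂⁿ`, real on the bottom edge and proper into the ball, and `D`
misses the top edge because `e` takes values in `U`, which is disjoint from `φ 1 '' L`
(`IsAdaptedPair.isHolomorphicPiece`). The density of `v^*ω` is `|∂_τ w|²` on `D` and nonnegative
everywhere, so it is enough to show that `w` has area at least `πr²/2`.

This is the monotonicity formula with free boundary. For a real centre `c` put `u = |w - c|²`; then
`Δu = 4|∂_τ w|²` and, by Cauchy–Schwarz, `|∇u|² ≤ 4u|∂_τ w|²`. The divergence of `h(u)∇u` integrates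
to zero over the strip: the cutoff `h` makes the field extend by zero, it is tangent to the bottom
edge since `w` and `c` are real there, and finite area kills the flux at infinity
(`integral_divergence_eq_zero`, `integral_le_zero`). Letting `h` approximate `1/max(x,a) - 1/b` on
`x ≤ b` shows that the area in `{u ≤ a}` divided by `a` is at most the total area divided by `b`
(`monotonicity`). If `∂_τ w ≠ 0` at a boundary point mapped to `c`, then for small `a` that quotient
is nearly at least `π/2`, as for a flat half-disc; this gives `π(r - |c|)²/2`
(`area_ge_of_tauDeriv_ne_zero`).

The point `(0,0)` may be critical for `w`. In that case noncritical boundary points near it are used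
and the bound passes to the limit (`area_ge`). They exist: otherwise `w` vanishes near `(0,0)`, and
unique continuation up the segment `{0} × [0,1]` would place `(0,1)` in `D`. -/

theorem mem_strip {z : ℝ × ℝ} : z ∈ strip ↔ 0 ≤ z.2 ∧ z.2 ≤ 1 := by
  simp [strip]

theorem isClosed_strip : IsClosed strip := isClosed_univ.prod isClosed_Icc

theorem measurableSet_strip : MeasurableSet strip := isClosed_strip.measurableSet

theorem uniqueDiffOn_strip : UniqueDiffOn ℝ strip :=
  uniqueDiffOn_univ.prod (uniqueDiffOn_Icc zero_lt_one)

theorem strip_mem_nhds {z : ℝ × ℝ} (h0 : 0 < z.2) (h1 : z.2 < 1) : strip ∈ 𝓝 z :=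
  prod_mem_nhds univ_mem (Icc_mem_nhds h0 h1)

variable {n : ℕ}

/-- `w : D → B(r)` is a holomorphic map on a relatively open subset of the strip which is real on
the bottom boundary, does not meet the top boundary, and is proper as a map to the open ball. -/
structure IsHolomorphicPiece (D : Set (ℝ × ℝ)) (w : ℝ × ℝ → Cn n) (r : ℝ) : Prop where
  subset : D ⊆ strip
  mem_nhds : ∀ z ∈ D, D ∈ 𝓝[strip] z
  contDiff : ∀ z ∈ D, ContDiffWithinAt ℝ ∞ w strip z
  cauchyRiemann : ∀ z ∈ D,
    fderivWithin ℝ w strip z (0, 1) = Complex.I • fderivWithin ℝ w strip z (1, 0)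
  real : ∀ τ : ℝ, (τ, (0 : ℝ)) ∈ D → ∀ j, (w (τ, 0) j).im = 0
  top : ∀ τ : ℝ, (τ, (1 : ℝ)) ∉ D
  isClosed : ∀ s < r, IsClosed {z | z ∈ D ∧ ‖w z‖ ≤ s}

/-- `∂w/∂τ` for a map `w` of the strip to `ℂ^n`. -/
noncomputable def tauDeriv (w : ℝ × ℝ → Cn n) (z : ℝ × ℝ) : Cn n := fderivWithin ℝ w strip z (1, 0)

/-- The complex multiple `(x, y) ↦ (x + i y) • a` as a real linear map. -/
noncomputable def complexSmul (a : Cn n) : ℝ × ℝ →L[ℝ] Cn n :=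
  (ContinuousLinearMap.fst ℝ ℝ ℝ).smulRight a +
    (ContinuousLinearMap.snd ℝ ℝ ℝ).smulRight (Complex.I • a)

theorem complexSmul_apply (a : Cn n) (y : ℝ × ℝ) :
    complexSmul a y = (⟨y.1, y.2⟩ : ℂ) • a := by
  have : (⟨y.1, y.2⟩ : ℂ) = y.1 + y.2 * Complex.I := by
    apply Complex.ext <;> simp
  rw [this, add_smul, mul_smul]
  simp [complexSmul]

theorem eq_complexSmul {L : ℝ × ℝ →L[ℝ] Cn n} (h : L (0, 1) = Complex.I • L (1, 0)) :
    L = complexSmul (L (1, 0)) := by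
  refine ContinuousLinearMap.ext fun y => ?_
  have : y = y.1 • ((1 : ℝ), (0 : ℝ)) + y.2 • ((0 : ℝ), (1 : ℝ)) := by ext <;> simp
  conv_lhs => rw [this]
  rw [map_add, map_smul, map_smul, h]
  simp [complexSmul]

/-- `D` need not be closed, so extension by zero could jump at its frontier. The closed set `K ⊆ D`
carrying `F` prevents this: a point outside `D` has a neighbourhood missing `K`. -/
theorem continuousOn_indicator_of_isClosed {X : Type*} [TopologicalSpace X] {S D K : Set X}
    {F : X → ℝ} (hD : ∀ z ∈ D, D ∈ 𝓝[S] z) (hF : ContinuousOn F D) (hK : IsClosed K)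
    (h0 : ∀ z ∈ D, z ∉ K → F z = 0) (hKD : K ⊆ D) : ContinuousOn (D.indicator F) S := by
  intro z hz
  by_cases hzD : z ∈ D
  · have h1 : ContinuousWithinAt F S z := (hF z hzD).mono_of_mem_nhdsWithin (hD z hzD)
    refine h1.congr_of_eventuallyEq ?_ (indicator_of_mem hzD F)
    filter_upwards [hD z hzD] with y hy using indicator_of_mem hy F
  · have h1 : Kᶜ ∈ 𝓝[S] z := nhdsWithin_le_nhds (hK.isOpen_compl.mem_nhds fun h => hzD (hKD h))
    have h2 : ∀ y ∈ Kᶜ, D.indicator F y = 0 := fun y hy => by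
      by_cases hyD : y ∈ D
      · rw [indicator_of_mem hyD, h0 y hyD hy]
      · exact indicator_of_notMem hyD F
    refine (continuousWithinAt_const (b := (0 : ℝ))).congr_of_eventuallyEq ?_
      (indicator_of_notMem hzD F)
    filter_upwards [h1] with y hy using h2 y hy

theorem hasFDerivAt_indicator_of_isClosed {D K : Set (ℝ × ℝ)}
    {F : ℝ × ℝ → ℝ} {F' : ℝ × ℝ → ℝ × ℝ →L[ℝ] ℝ} {z : ℝ × ℝ} (hz : strip ∈ 𝓝 z)
    (hD : ∀ z ∈ D, D ∈ 𝓝[strip] z) (hF : z ∈ D → HasFDerivAt F (F' z) z) (hK : IsClosed K)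
    (h0 : ∀ z ∈ D, z ∉ K → F z = 0) (hKD : K ⊆ D) :
    HasFDerivAt (D.indicator F) (D.indicator F' z) z := by
  by_cases hzD : z ∈ D
  · rw [indicator_of_mem hzD]
    refine (hF hzD).congr_of_eventuallyEq ?_
    have := hD z hzD
    rw [nhdsWithin_eq_nhds.2 hz] at this
    filter_upwards [this] with y hy using indicator_of_mem hy F
  · rw [indicator_of_notMem hzD]
    refine (hasFDerivAt_const (0 : ℝ) z).congr_of_eventuallyEq ?_
    filter_upwards [hK.isOpen_compl.mem_nhds fun h => hzD (hKD h)] with y hy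
    by_cases hyD : y ∈ D
    · rw [indicator_of_mem hyD, h0 y hyD hy]
    · exact indicator_of_notMem hyD F

namespace IsHolomorphicPiece

variable {D : Set (ℝ × ℝ)} {w : ℝ × ℝ → Cn n} {r : ℝ}

theorem measurableSet (hw : IsHolomorphicPiece D w r) : MeasurableSet D := by
  have h : ∀ z ∈ D, ∃ V : Set (ℝ × ℝ), IsOpen V ∧ z ∈ V ∧ V ∩ strip ⊆ D := fun z hz =>
    mem_nhdsWithin.1 (hw.mem_nhds z hz)
  choose! V hV hzV hVD using h
  have : D = (⋃ z ∈ D, V z) ∩ strip := by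
    ext y
    constructor
    · intro hy
      exact ⟨mem_iUnion₂.2 ⟨y, hy, hzV y hy⟩, hw.subset hy⟩
    · rintro ⟨h1, h2⟩
      obtain ⟨z, hz, hy⟩ := mem_iUnion₂.1 h1
      exact hVD z hz ⟨hy, h2⟩
  rw [this]
  exact (isOpen_biUnion hV).measurableSet.inter measurableSet_strip

theorem continuousOn (hw : IsHolomorphicPiece D w r) : ContinuousOn w D := fun z hz =>
  (hw.contDiff z hz).continuousWithinAt.mono hw.subset

theorem hasFDerivWithinAt (hw : IsHolomorphicPiece D w r) {z : ℝ × ℝ} (hz : z ∈ D) :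
    HasFDerivWithinAt w (complexSmul (tauDeriv w z)) strip z := by
  have h := ((hw.contDiff z hz).differentiableWithinAt (by simp)).hasFDerivWithinAt
  rwa [eq_complexSmul (hw.cauchyRiemann z hz)] at h

theorem hasFDerivAt (hw : IsHolomorphicPiece D w r) {z : ℝ × ℝ} (hz : z ∈ D) (h0 : 0 < z.2)
    (h1 : z.2 < 1) : HasFDerivAt w (complexSmul (tauDeriv w z)) z :=
  (hw.hasFDerivWithinAt hz).hasFDerivAt (strip_mem_nhds h0 h1)

theorem continuousOn_tauDeriv (hw : IsHolomorphicPiece D w r) : ContinuousOn (tauDeriv w) D := by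
  intro z hz
  have h := ((hw.contDiff z hz).fderivWithin_right (m := 0) uniqueDiffOn_strip (by simp)
    (hw.subset hz)).continuousWithinAt
  exact (h.clm_apply continuousWithinAt_const).mono hw.subset

/-- The map `w` as a function of one complex variable is complex differentiable. -/
theorem hasDerivAt (hw : IsHolomorphicPiece D w r) {ζ : ℂ} (hz : (ζ.re, ζ.im) ∈ D) (h0 : 0 < ζ.im)
    (h1 : ζ.im < 1) :
    HasDerivAt (fun ζ : ℂ => w (ζ.re, ζ.im)) (tauDeriv w (ζ.re, ζ.im)) ζ := by
  have h := hw.hasFDerivAt hz h0 h1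
  have h2 : HasFDerivAt (fun ζ : ℂ => (ζ.re, ζ.im)) (Complex.reCLM.prod Complex.imCLM) ζ :=
    Complex.reCLM.hasFDerivAt.prodMk Complex.imCLM.hasFDerivAt
  have h3 := HasFDerivAt.comp ζ h h2
  rw [hasDerivAt_iff_hasFDerivAt]
  refine hasFDerivAt_of_restrictScalars ℝ h3 ?_
  ext1 y
  simp [complexSmul_apply]

theorem isOpen_complex (hw : IsHolomorphicPiece D w r) :
    IsOpen {ζ : ℂ | (ζ.re, ζ.im) ∈ D ∧ 0 < ζ.im ∧ ζ.im < 1} := by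
  rw [isOpen_iff_mem_nhds]
  rintro ζ ⟨h, h0, h1⟩
  have h2 := hw.mem_nhds _ h
  rw [nhdsWithin_eq_nhds.2 (strip_mem_nhds h0 h1)] at h2
  have hc : Continuous fun ζ : ℂ => (ζ.re, ζ.im) := by fun_prop
  filter_upwards [hc.continuousAt.preimage_mem_nhds h2,
    (Complex.continuous_im.continuousAt.eventually_lt continuousAt_const h1),
    (continuousAt_const.eventually_lt Complex.continuous_im.continuousAt h0)] with y h3 h4 h5
  exact ⟨h3, h5, h4⟩

/-- The derivative of a holomorphic map is again holomorphic. The complex-linear shape of this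
second derivative is what makes the components of `w` harmonic. -/
theorem exists_hasFDerivAt_tauDeriv (hw : IsHolomorphicPiece D w r) {z : ℝ × ℝ} (hz : z ∈ D)
    (h0 : 0 < z.2) (h1 : z.2 < 1) :
    ∃ a : Cn n, HasFDerivAt (tauDeriv w) (complexSmul a) z := by
  set O := {ζ : ℂ | (ζ.re, ζ.im) ∈ D ∧ 0 < ζ.im ∧ ζ.im < 1}
  set W := fun ζ : ℂ => w (ζ.re, ζ.im)
  have hO : IsOpen O := hw.isOpen_complex
  have hd : DifferentiableOn ℂ W O := fun ζ hζ =>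
    (hw.hasDerivAt hζ.1 hζ.2.1 hζ.2.2).differentiableAt.differentiableWithinAt
  have hζ : (⟨z.1, z.2⟩ : ℂ) ∈ O := ⟨hz, h0, h1⟩
  have h2 := ((hd.deriv hO).differentiableAt (hO.mem_nhds hζ)).hasDerivAt
  refine ⟨deriv (deriv W) ⟨z.1, z.2⟩, ?_⟩
  have h3 : HasFDerivAt (fun y : ℝ × ℝ => (⟨y.1, y.2⟩ : ℂ))
      (Complex.equivRealProdCLM.symm : ℝ × ℝ →L[ℝ] ℂ) z :=
    Complex.equivRealProdCLM.symm.hasFDerivAt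
  have h4 := (h2.hasFDerivAt.restrictScalars ℝ).comp z h3
  have h5 : HasFDerivAt (fun y : ℝ × ℝ => deriv W ⟨y.1, y.2⟩)
      (complexSmul (deriv (deriv W) ⟨z.1, z.2⟩)) z := by
    refine h4.congr_fderiv (ContinuousLinearMap.ext fun y => ?_)
    rw [complexSmul_apply]
    rfl
  refine h5.congr_of_eventuallyEq ?_
  have h6 := h3.continuousAt.preimage_mem_nhds (hO.mem_nhds hζ)
  filter_upwards [h6] with y hy
  exact (hw.hasDerivAt hy.1 hy.2.1 hy.2.2).deriv.symm

/-- The boundary condition differentiated along the boundary; it makes the gradient field tangent to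
the bottom edge. -/
theorem tauDeriv_real (hw : IsHolomorphicPiece D w r) {τ : ℝ} (h : (τ, (0 : ℝ)) ∈ D) (j : Fin n) :
    (tauDeriv w (τ, 0) j).im = 0 := by
  have h1 := hw.hasFDerivWithinAt h
  have h2 : HasDerivAt (fun s : ℝ => (s, (0 : ℝ))) (1, 0) τ :=
    (hasDerivAt_id τ).prodMk (hasDerivAt_const _ _)
  have h3 : HasDerivAt (fun s : ℝ => w (s, 0)) (tauDeriv w (τ, 0)) τ := by
    have := h1.comp_hasDerivAt τ h2 (Eventually.of_forall fun s => by simp [mem_strip])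
    rwa [complexSmul_apply, show (⟨((1 : ℝ), (0 : ℝ)).1, ((1 : ℝ), (0 : ℝ)).2⟩ : ℂ) = 1 from rfl,
      one_smul] at this
  have h4 : HasDerivAt (fun s : ℝ => (w (s, 0) j).im) (tauDeriv w (τ, 0) j).im τ := by
    have h5 := (Complex.imCLM.comp
      ((EuclideanSpace.proj (𝕜 := ℂ) j).restrictScalars ℝ)).hasFDerivAt.comp_hasDerivAt τ h3
    exact h5
  have h5 : (fun s : ℝ => (w (s, 0) j).im) =ᶠ[𝓝 τ] fun _ => 0 := by
    have h6 : Tendsto (fun s : ℝ => (s, (0 : ℝ))) (𝓝 τ) (𝓝[strip] (τ, 0)) :=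
      tendsto_nhdsWithin_iff.2 ⟨h2.continuousAt.tendsto,
        Eventually.of_forall fun s => by simp [mem_strip]⟩
    filter_upwards [h6 (hw.mem_nhds _ h)] with s hs using hw.real s hs j
  rw [← h4.deriv, h5.deriv_eq, deriv_const]

end IsHolomorphicPiece

end

/-! ### The divergence theorem on the strip and the weighted area inequality -/

section

variable {n : ℕ}

namespace IsHolomorphicPiece

variable {D : Set (ℝ × ℝ)} {w : ℝ × ℝ → Cn n} {r : ℝ}

/-- The divergence of the gradient field of a function of `|w - c|²` with derivative `h`. -/
theorem exists_fderiv_field (hw : IsHolomorphicPiece D w r) (c : Cn n) {h k : ℝ → ℝ}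
    (hk : ∀ x, HasDerivAt h (-k x) x) {z : ℝ × ℝ} (hz : z ∈ D) (h0 : 0 < z.2) (h1 : z.2 < 1) :
    ∃ P' Q' : ℝ × ℝ →L[ℝ] ℝ,
      HasFDerivAt (fun z => 2 * h (‖w z - c‖ ^ 2) * (inner ℂ (w z - c) (tauDeriv w z)).re) P' z ∧
      HasFDerivAt (fun z => -2 * h (‖w z - c‖ ^ 2) * (inner ℂ (w z - c) (tauDeriv w z)).im) Q' z ∧
      P' (1, 0) + Q' (0, 1) = 4 * h (‖w z - c‖ ^ 2) * ‖tauDeriv w z‖ ^ 2 -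
        4 * k (‖w z - c‖ ^ 2) * ‖inner ℂ (w z - c) (tauDeriv w z)‖ ^ 2 := by
  -- The field is `h(u)∇u` with `u = |w - c|²`. The terms in the second derivative `a` cancel, since
  -- `-Im⟨w - c, i a⟩ = -Re⟨w - c, a⟩`.
  obtain ⟨a, ha⟩ := hw.exists_hasFDerivAt_tauDeriv hz h0 h1
  have hd := (hw.hasFDerivAt hz h0 h1).sub_const c
  set A := tauDeriv w z
  have hq := hd.inner ℂ ha
  have hu := Complex.reCLM.hasFDerivAt.comp z (hd.inner ℂ hd)
  have hu' : HasFDerivAt (fun z => ‖w z - c‖ ^ 2) _ z := hu.congr_of_eventuallyEq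
    (Eventually.of_forall fun y => (inner_self_eq_norm_sq (𝕜 := ℂ) (w y - c)).symm)
  have hh := (hk (‖w z - c‖ ^ 2)).comp_hasFDerivAt z hu'
  have hre := Complex.reCLM.hasFDerivAt.comp z hq
  have him := Complex.imCLM.hasFDerivAt.comp z hq
  refine ⟨_, _, (hh.const_mul 2).mul hre, (hh.const_mul (-2)).mul him, ?_⟩
  have e10 : (⟨1, 0⟩ : ℂ) = 1 := rfl
  have e01 : (⟨0, 1⟩ : ℂ) = Complex.I := rfl
  have hAA : inner ℂ A A = ((‖A‖ ^ 2 : ℝ) : ℂ) := by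
    rw [inner_self_eq_norm_sq_to_K]; push_cast; rfl
  have hconj : inner ℂ A (w z - c) = (starRingEnd ℂ) (inner ℂ (w z - c) A) :=
    (inner_conj_symm A (w z - c)).symm
  have hsq : ‖inner ℂ (w z - c) A‖ ^ 2 =
      (inner ℂ (w z - c) A).re ^ 2 + (inner ℂ (w z - c) A).im ^ 2 := by
    rw [Complex.sq_norm, Complex.normSq_apply]; ring
  have hA : tauDeriv w z = A := rfl
  simp only [add_apply, smul_apply,
    ContinuousLinearMap.comp_apply, fderivInnerCLM_apply, ContinuousLinearMap.prod_apply,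
    complexSmul_apply, e10, e01, one_smul, inner_smul_left, inner_smul_right, hA, hAA, hconj, hsq,
    Complex.reCLM_apply, Complex.imCLM_apply, Function.comp_apply, smul_eq_mul, map_add,
    Complex.conj_I, Complex.mul_re, Complex.mul_im, Complex.neg_re, Complex.neg_im, Complex.I_re,
    Complex.I_im, Complex.ofReal_re, Complex.ofReal_im, Complex.conj_re, Complex.conj_im]
  ring

end IsHolomorphicPiece

/-- A function whose increments over symmetric intervals are dominated by square roots of
integrable quantities has vanishing limit. -/
theorem eq_zero_of_tendsto_of_sq_integrable {p m : ℝ → ℝ} {l : ℝ} (hm : Integrable m)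
    (hp : ∀ η > 0, ∀ R, |p R| ≤ η + m R / (4 * η))
    (hl : Tendsto (fun R => p R - p (-R)) atTop (𝓝 l)) : l = 0 := by
  by_contra hne
  have hpos : 0 < |l| := abs_pos.2 hne
  have h1 : ∀ᶠ R in atTop, |l| / 2 < |p R - p (-R)| :=
    hl.abs.eventually (lt_mem_nhds (half_lt_self hpos))
  obtain ⟨R₀, hR₀⟩ := eventually_atTop.1 h1
  -- With `η = |l|/8` at both `R` and `-R`, a nonzero limit forces this integrable function to be at
  -- least `l²/8` on a whole half-line.
  have hint : Integrable (fun R => m R + m (-R)) := hm.add hm.comp_neg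
  have h2 : Ici R₀ ⊆ {R | |l| ^ 2 / 8 ≤ m R + m (-R)} := by
    intro R hR
    have h3 := hR₀ R hR
    have h4 := hp (|l| / 8) (by positivity) R
    have h5 := hp (|l| / 8) (by positivity) (-R)
    have h6 := abs_sub (p R) (p (-R))
    have h7 : |l| / 4 ≤ (m R + m (-R)) / (4 * (|l| / 8)) := by rw [add_div]; linarith
    rw [le_div_iff₀ (by positivity)] at h7
    simp only [mem_ofPred_eq]
    nlinarith
  have h3 := (measure_mono h2).trans_lt (hint.measure_ge_lt_top (by positivity))
  simp at h3

theorem iUnion_Icc_eq_strip :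
    ⋃ R : ℝ, Icc ((-R, 0) : ℝ × ℝ) (R, 1) = strip := by
  ext z
  simp only [mem_iUnion, mem_Icc, Prod.le_def, mem_strip]
  constructor
  · rintro ⟨R, ⟨-, h1⟩, -, h2⟩
    exact ⟨h1, h2⟩
  · rintro ⟨h1, h2⟩
    exact ⟨|z.1|, ⟨neg_abs_le _, h1⟩, le_abs_self _, h2⟩

theorem volume_restrict_strip :
    (volume : Measure (ℝ × ℝ)).restrict strip =
      (volume : Measure ℝ).prod ((volume : Measure ℝ).restrict (Icc 0 1)) := by
  rw [strip, Measure.volume_eq_prod, ← Measure.prod_restrict, Measure.restrict_univ]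

/-- The integral over the strip of the divergence of a square integrable vector field which is
tangent to the boundary vanishes. -/
theorem integral_divergence_eq_zero {P Q d : ℝ × ℝ → ℝ} (hP : ContinuousOn P strip)
    (hQ : ContinuousOn Q strip) (hd : IntegrableOn d strip)
    (hP2 : IntegrableOn (fun z => P z ^ 2) strip)
    (hder : ∀ z : ℝ × ℝ, 0 < z.2 → z.2 < 1 → ∃ P' Q' : ℝ × ℝ →L[ℝ] ℝ,
      HasFDerivAt P P' z ∧ HasFDerivAt Q Q' z ∧ P' (1, 0) + Q' (0, 1) = d z)
    (hbot : ∀ τ, Q (τ, 0) = 0) (htop : ∀ τ, Q (τ, 1) = 0) : ∫ z in strip, d z = 0 := by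
  have hex : ∀ z : ℝ × ℝ, ∃ P' Q' : ℝ × ℝ →L[ℝ] ℝ,
      (0 < z.2 → z.2 < 1 → HasFDerivAt P P' z ∧ HasFDerivAt Q Q' z) ∧
        P' (1, 0) + Q' (0, 1) = d z := by
    intro z
    by_cases h : 0 < z.2 ∧ z.2 < 1
    · obtain ⟨P', Q', h1, h2, h3⟩ := hder z h.1 h.2
      exact ⟨P', Q', fun _ _ => ⟨h1, h2⟩, h3⟩
    -- Dummy derivatives outside the open strip, chosen so that the divergence equals `d` at every
    -- point.
    · exact ⟨d z • ContinuousLinearMap.fst ℝ ℝ ℝ, 0, fun h0 h1 => (h ⟨h0, h1⟩).elim, by simp⟩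
  choose P' Q' hPQ hsum using hex
  -- `p` is the flux through a vertical segment. It is controlled by `m`, which is integrable in `τ`
  -- by Fubini.
  set p : ℝ → ℝ := fun τ => ∫ t in (0 : ℝ)..1, P (τ, t)
  set m : ℝ → ℝ := fun τ => ∫ t in Icc (0 : ℝ) 1, P (τ, t) ^ 2
  have hsub : ∀ R : ℝ, Icc ((-R, 0) : ℝ × ℝ) (R, 1) ⊆ strip := fun R =>
    (subset_iUnion (fun R : ℝ => Icc ((-R, 0) : ℝ × ℝ) (R, 1)) R).trans iUnion_Icc_eq_strip.subset
  have hbox : ∀ R : ℝ, 0 ≤ R → ∫ z in Icc ((-R, 0) : ℝ × ℝ) (R, 1), d z = p R - p (-R) := by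
    intro R hR
    have h := integral_divergence_prod_Icc_of_hasFDerivAt_of_le P Q P' Q' (-R, 0) (R, 1)
      (Prod.mk_le_mk.2 ⟨by linarith, zero_le_one⟩) (hP.mono (hsub R)) (hQ.mono (hsub R))
      (fun z hz => (hPQ z hz.2.1 hz.2.2).1) (fun z hz => (hPQ z hz.2.1 hz.2.2).2)
      (by simpa only [hsum] using hd.mono_set (hsub R))
    simpa [hsum, hbot, htop, p] using h
  have hlim : Tendsto (fun R : ℝ => ∫ z in Icc ((-R, 0) : ℝ × ℝ) (R, 1), d z) atTop
      (𝓝 (∫ z in strip, d z)) := by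
    have h := tendsto_setIntegral_of_monotone (μ := volume) (f := d)
      (s := fun R : ℝ => Icc ((-R, 0) : ℝ × ℝ) (R, 1)) (fun R => measurableSet_Icc)
      (fun R S h => Icc_subset_Icc (Prod.mk_le_mk.2 ⟨neg_le_neg h, le_rfl⟩)
        (Prod.mk_le_mk.2 ⟨h, le_rfl⟩)) (by rwa [iUnion_Icc_eq_strip])
    rwa [iUnion_Icc_eq_strip] at h
  have hm : Integrable m := by
    have h : Integrable (fun z => P z ^ 2)
        ((volume : Measure ℝ).prod ((volume : Measure ℝ).restrict (Icc 0 1))) := by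
      rw [← volume_restrict_strip]; exact hP2
    exact h.integral_prod_left
  refine eq_zero_of_tendsto_of_sq_integrable (p := p) hm ?_ (hlim.congr' ?_)
  · intro η hη R
    have hc : ContinuousOn (fun t : ℝ => P (R, t)) (Icc 0 1) :=
      hP.comp (by fun_prop) fun t ht => ⟨mem_univ _, ht⟩
    have h1 : |p R| ≤ ∫ t in Icc (0 : ℝ) 1, |P (R, t)| := by
      rw [integral_Icc_eq_integral_Ioc, ← intervalIntegral.integral_of_le zero_le_one]
      exact intervalIntegral.abs_integral_le_integral_abs zero_le_one
    have h2 : ∫ t in Icc (0 : ℝ) 1, |P (R, t)| ≤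
        ∫ t in Icc (0 : ℝ) 1, (η + P (R, t) ^ 2 / (4 * η)) := by
      refine setIntegral_mono_on (hc.abs.integrableOn_Icc)
        ((continuousOn_const.add ((hc.pow 2).div_const _)).integrableOn_Icc) measurableSet_Icc ?_
      intro t _
      -- `|x| ≤ η + x²/(4η)` is the expansion of `(2η - |x|)² ≥ 0`.
      rw [← sub_le_iff_le_add', le_div_iff₀ (by positivity)]
      have := sq_abs (P (R, t))
      nlinarith [sq_nonneg (2 * η - |P (R, t)|)]
    have h3 : ∫ t in Icc (0 : ℝ) 1, (η + P (R, t) ^ 2 / (4 * η)) = η + m R / (4 * η) := by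
      have hi : IntegrableOn (fun t : ℝ => P (R, t) ^ 2 / (4 * η)) (Icc 0 1) :=
        ((hc.pow 2).div_const _).integrableOn_Icc
      rw [integral_add (continuousOn_const.integrableOn_Icc) hi, integral_div]
      simp [m]
    linarith
  · filter_upwards [eventually_ge_atTop 0] with R hR using hbox R hR

namespace IsHolomorphicPiece

variable {D : Set (ℝ × ℝ)} {w : ℝ × ℝ → Cn n} {r : ℝ}

theorem isClosed_closedBall (hw : IsHolomorphicPiece D w r) {c : Cn n} {ρ : ℝ}
    (hc : ‖c‖ + ρ < r) : IsClosed {z | z ∈ D ∧ ‖w z - c‖ ≤ ρ} := by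
  have h : {z | z ∈ D ∧ ‖w z - c‖ ≤ ρ} =
      {z | z ∈ D ∧ ‖w z‖ ≤ ‖c‖ + ρ} ∩ w ⁻¹' Metric.closedBall c ρ := by
    ext z
    simp only [mem_ofPred_eq, mem_inter_iff, mem_preimage, mem_closedBall_iff_norm]
    constructor
    · rintro ⟨h1, h2⟩
      exact ⟨⟨h1, by linarith [norm_le_norm_add_norm_sub' (w z) c]⟩, h2⟩
    · rintro ⟨⟨h1, -⟩, h2⟩
      exact ⟨h1, h2⟩
  rw [h]
  exact (hw.continuousOn.mono fun z hz => hz.1).preimage_isClosed_of_isClosed (hw.isClosed _ hc)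
    Metric.isClosed_closedBall

/-- The divergence `4h|∂_τ w|² - 4k|⟨w - c, ∂_τ w⟩|²` of `h(u)∇u` has integral zero, and
Cauchy–Schwarz with `k ≥ 0` bounds it below by four times the integrand here. The condition `‖c‖ + ρ
< r` keeps the support of the field closed in the plane. -/
theorem integral_le_zero (hw : IsHolomorphicPiece D w r)
    (hE : IntegrableOn (fun z => ‖tauDeriv w z‖ ^ 2) D) {c : Cn n} (hcr : ∀ j, (c j).im = 0)
    {ρ : ℝ} (hρ : 0 < ρ) (hc : ‖c‖ + ρ < r) {h k : ℝ → ℝ}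
    (hk : ∀ x, HasDerivAt h (-k x) x) (hkc : Continuous k) (hk0 : ∀ x, 0 ≤ k x)
    (hhb : ∀ x, ρ ^ 2 ≤ x → h x = 0) (hkb : ∀ x, ρ ^ 2 ≤ x → k x = 0) :
    IntegrableOn (fun z => ‖tauDeriv w z‖ ^ 2 *
      (h (‖w z - c‖ ^ 2) - ‖w z - c‖ ^ 2 * k (‖w z - c‖ ^ 2))) D ∧
    ∫ z in D, ‖tauDeriv w z‖ ^ 2 *
      (h (‖w z - c‖ ^ 2) - ‖w z - c‖ ^ 2 * k (‖w z - c‖ ^ 2)) ≤ 0 := by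
  have hhc : Continuous h := continuous_iff_continuousAt.2 fun x => (hk x).continuousAt
  set u : ℝ × ℝ → ℝ := fun z => ‖w z - c‖ ^ 2 with hu
  set q : ℝ × ℝ → ℂ := fun z => inner ℂ (w z - c) (tauDeriv w z) with hq
  set K : Set (ℝ × ℝ) := {z | z ∈ D ∧ ‖w z - c‖ ≤ ρ}
  have hK : IsClosed K := hw.isClosed_closedBall hc
  have hKD : K ⊆ D := fun z hz => hz.1
  have huK : ∀ z ∈ D, z ∉ K → ρ ^ 2 ≤ u z := fun z hz hzK => by
    have : ρ < ‖w z - c‖ := not_le.1 fun h => hzK ⟨hz, h⟩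
    exact pow_le_pow_left₀ hρ.le this.le 2
  have hcw : ContinuousOn (fun z => w z - c) D := hw.continuousOn.sub continuousOn_const
  have hcu : ContinuousOn u D := hcw.norm.pow 2
  have hcq : ContinuousOn q D := hcw.inner hw.continuousOn_tauDeriv
  have hchu : ContinuousOn (fun z => h (u z)) D := hhc.comp_continuousOn hcu
  have hcku : ContinuousOn (fun z => k (u z)) D := hkc.comp_continuousOn hcu
  set P : ℝ × ℝ → ℝ := fun z => 2 * h (u z) * (q z).re
  set Q : ℝ × ℝ → ℝ := fun z => -2 * h (u z) * (q z).im
  set d : ℝ × ℝ → ℝ := fun z =>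
    4 * h (u z) * ‖tauDeriv w z‖ ^ 2 - 4 * k (u z) * ‖q z‖ ^ 2
  have hcP : ContinuousOn P D :=
    (continuousOn_const.mul hchu).mul (Complex.continuous_re.comp_continuousOn hcq)
  have hcQ : ContinuousOn Q D :=
    (continuousOn_const.mul hchu).mul (Complex.continuous_im.comp_continuousOn hcq)
  have hcd : ContinuousOn d D :=
    ((continuousOn_const.mul hchu).mul (hw.continuousOn_tauDeriv.norm.pow 2)).sub
      ((continuousOn_const.mul hcku).mul (hcq.norm.pow 2))
  have hP0 : ∀ z ∈ D, z ∉ K → P z = 0 := fun z hz hzK => by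
    simp [P, hhb _ (huK z hz hzK)]
  have hQ0 : ∀ z ∈ D, z ∉ K → Q z = 0 := fun z hz hzK => by
    simp [Q, hhb _ (huK z hz hzK)]
  obtain ⟨C, hC⟩ : ∃ C, ∀ x ∈ Icc 0 (ρ ^ 2), |h x| ≤ C :=
    isCompact_Icc.exists_bound_of_continuousOn hhc.continuousOn
  obtain ⟨C', hC'⟩ : ∃ C, ∀ x ∈ Icc 0 (ρ ^ 2), |k x| ≤ C :=
    isCompact_Icc.exists_bound_of_continuousOn hkc.continuousOn
  have hC0 : 0 ≤ C := (abs_nonneg _).trans (hC 0 ⟨le_rfl, by positivity⟩)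
  have hC0' : 0 ≤ C' := (abs_nonneg _).trans (hC' 0 ⟨le_rfl, by positivity⟩)
  have hqle : ∀ z, ‖q z‖ ^ 2 ≤ u z * ‖tauDeriv w z‖ ^ 2 := fun z => by
    rw [hu, ← mul_pow]
    exact pow_le_pow_left₀ (norm_nonneg _) (norm_inner_le_norm _ _) 2
  have hu0 : ∀ z, 0 ≤ u z := fun z => by positivity
  have hDm := hw.measurableSet
  -- All integrands are dominated by multiples of `|∂_τ w|²`, because `h` and `k` are bounded on
  -- `[0, ρ²]` and vanish beyond it.
  have hdom : ∀ {F : ℝ × ℝ → ℝ} (B : ℝ), ContinuousOn F D →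
      (∀ z ∈ D, |F z| ≤ B * ‖tauDeriv w z‖ ^ 2) → IntegrableOn F D := by
    intro F B hF hB
    refine Integrable.mono' (hE.const_mul B) (hF.aestronglyMeasurable hDm) ?_
    filter_upwards [ae_restrict_mem hDm] with z hz using hB z hz
  have hdI : IntegrableOn d D := by
    refine hdom (4 * C + 4 * C' * ρ ^ 2) hcd fun z hz => ?_
    by_cases hzb : ρ ^ 2 ≤ u z
    · simp only [d, hhb _ hzb, hkb _ hzb]
      simp only [mul_zero, zero_mul, sub_zero, abs_zero]
      positivity
    · have h1 := hC (u z) ⟨hu0 z, (not_le.1 hzb).le⟩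
      have h2 := hC' (u z) ⟨hu0 z, (not_le.1 hzb).le⟩
      have h3 : ‖q z‖ ^ 2 ≤ ρ ^ 2 * ‖tauDeriv w z‖ ^ 2 :=
        (hqle z).trans (mul_le_mul_of_nonneg_right (not_le.1 hzb).le (by positivity))
      have h4 := abs_sub (4 * h (u z) * ‖tauDeriv w z‖ ^ 2) (4 * k (u z) * ‖q z‖ ^ 2)
      have h5 : |4 * h (u z) * ‖tauDeriv w z‖ ^ 2| = 4 * |h (u z)| * ‖tauDeriv w z‖ ^ 2 := by
        rw [abs_mul, abs_mul, abs_of_nonneg (by positivity : 0 ≤ ‖tauDeriv w z‖ ^ 2)]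
        norm_num
      have h6 : |4 * k (u z) * ‖q z‖ ^ 2| = 4 * |k (u z)| * ‖q z‖ ^ 2 := by
        rw [abs_mul, abs_mul, abs_of_nonneg (by positivity : 0 ≤ ‖q z‖ ^ 2)]
        norm_num
      have h7 : |h (u z)| * ‖tauDeriv w z‖ ^ 2 ≤ C * ‖tauDeriv w z‖ ^ 2 := by gcongr
      have h8 : |k (u z)| * ‖q z‖ ^ 2 ≤ C' * (ρ ^ 2 * ‖tauDeriv w z‖ ^ 2) := by gcongr
      simp only [d]
      linarith
  have hPI : IntegrableOn (fun z => P z ^ 2) D := by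
    refine hdom (4 * C ^ 2 * ρ ^ 2) (hcP.pow 2) fun z hz => ?_
    by_cases hzb : ρ ^ 2 ≤ u z
    · simp only [P, hhb _ hzb]
      simp only [mul_zero, zero_mul, ne_eq, OfNat.ofNat_ne_zero, not_false_eq_true, zero_pow,
        abs_zero]
      positivity
    · have h1 := hC (u z) ⟨hu0 z, (not_le.1 hzb).le⟩
      have h3 : ‖q z‖ ^ 2 ≤ ρ ^ 2 * ‖tauDeriv w z‖ ^ 2 :=
        (hqle z).trans (mul_le_mul_of_nonneg_right (not_le.1 hzb).le (by positivity))
      have h2 : (q z).re ^ 2 ≤ ‖q z‖ ^ 2 := by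
        rw [← sq_abs]
        exact pow_le_pow_left₀ (abs_nonneg _) (Complex.abs_re_le_norm _) 2
      have h4 : h (u z) ^ 2 ≤ C ^ 2 := by
        rw [← sq_abs]
        exact pow_le_pow_left₀ (abs_nonneg _) h1 2
      rw [abs_of_nonneg (sq_nonneg _)]
      calc P z ^ 2 = 4 * (h (u z) ^ 2 * (q z).re ^ 2) := by simp only [P]; ring
        _ ≤ 4 * (C ^ 2 * (ρ ^ 2 * ‖tauDeriv w z‖ ^ 2)) := by
          gcongr
          exact h2.trans h3
        _ = _ := by ring
  have hFI : IntegrableOn (fun z => ‖tauDeriv w z‖ ^ 2 * (h (u z) - u z * k (u z))) D := by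
    refine hdom (C + ρ ^ 2 * C') ((hw.continuousOn_tauDeriv.norm.pow 2).mul
      (hchu.sub (hcu.mul hcku))) fun z hz => ?_
    rw [abs_mul, abs_of_nonneg (by positivity : 0 ≤ ‖tauDeriv w z‖ ^ 2), mul_comm]
    refine mul_le_mul_of_nonneg_right ?_ (by positivity)
    by_cases hzb : ρ ^ 2 ≤ u z
    · rw [hhb _ hzb, hkb _ hzb]
      simp only [mul_zero, sub_zero, abs_zero]
      positivity
    · have h1 := hC (u z) ⟨hu0 z, (not_le.1 hzb).le⟩
      have h2 := hC' (u z) ⟨hu0 z, (not_le.1 hzb).le⟩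
      refine (abs_sub _ _).trans (add_le_add h1 ?_)
      rw [abs_mul, abs_of_nonneg (hu0 z)]
      exact mul_le_mul (not_le.1 hzb).le h2 (abs_nonneg _) (by positivity)
  refine ⟨hFI, ?_⟩
  have hdiv : ∫ z in strip, D.indicator d z = 0 := by
    refine integral_divergence_eq_zero (P := D.indicator P) (Q := D.indicator Q)
      (continuousOn_indicator_of_isClosed hw.mem_nhds hcP hK hP0 hKD)
      (continuousOn_indicator_of_isClosed hw.mem_nhds hcQ hK hQ0 hKD)
      ((integrable_indicator_iff hDm).2 hdI).integrableOn ?_ ?_ ?_ ?_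
    · have : (fun z => D.indicator P z ^ 2) = D.indicator fun z => P z ^ 2 := by
        ext z
        by_cases hz : z ∈ D <;> simp [hz]
      rw [this]
      exact ((integrable_indicator_iff hDm).2 hPI).integrableOn
    · intro z h0 h1
      by_cases hz : z ∈ D
      · obtain ⟨P', Q', h2, h3, h4⟩ := hw.exists_fderiv_field c hk hz h0 h1
        have h5 := hasFDerivAt_indicator_of_isClosed (F' := fun _ => P') (strip_mem_nhds h0 h1)
          hw.mem_nhds (fun _ => h2) hK hP0 hKD
        have h6 := hasFDerivAt_indicator_of_isClosed (F' := fun _ => Q') (strip_mem_nhds h0 h1)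
          hw.mem_nhds (fun _ => h3) hK hQ0 hKD
        rw [indicator_of_mem hz] at h5 h6
        exact ⟨P', Q', h5, h6, by rw [h4, indicator_of_mem hz]⟩
      · have h5 := hasFDerivAt_indicator_of_isClosed (F' := fun _ => 0) (strip_mem_nhds h0 h1)
          hw.mem_nhds (fun h => (hz h).elim) hK hP0 hKD
        have h6 := hasFDerivAt_indicator_of_isClosed (F' := fun _ => 0) (strip_mem_nhds h0 h1)
          hw.mem_nhds (fun h => (hz h).elim) hK hQ0 hKD
        rw [indicator_of_notMem hz] at h5 h6
        exact ⟨0, 0, h5, h6, by simp [indicator_of_notMem hz]⟩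
    · intro τ
      by_cases hz : (τ, (0 : ℝ)) ∈ D
      · rw [indicator_of_mem hz]
        -- On the bottom edge `w`, `c` and `∂_τ w` are all real, so the normal component of the
        -- field is zero.
        have : (q (τ, 0)).im = 0 := by
          simp only [hq, PiLp.inner_apply, Complex.im_sum]
          refine Finset.sum_eq_zero fun j _ => ?_
          simp [hw.real τ hz j, hcr j, hw.tauDeriv_real hz j]
        simp [Q, this]
      · exact indicator_of_notMem hz Q
    · intro τ
      exact indicator_of_notMem (hw.top τ) Q
  rw [setIntegral_indicator hDm, inter_eq_self_of_subset_right hw.subset] at hdiv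
  have hle : ∫ z in D, 4 * (‖tauDeriv w z‖ ^ 2 * (h (u z) - u z * k (u z))) ≤ ∫ z in D, d z := by
    refine setIntegral_mono_on (hFI.const_mul 4) hdI hDm fun z _ => ?_
    have := mul_le_mul_of_nonneg_left (hqle z) (hk0 (u z))
    simp only [d]
    linarith
  rw [integral_const_mul, hdiv] at hle
  linarith

end IsHolomorphicPiece

end

/-! ### The monotonicity formula and the area bound at a noncritical boundary point -/

section

variable {n : ℕ}

/-- A truncation of `1/x - 1/b` on `[a, b]`, extended by constants, with continuous derivative. -/
theorem exists_truncated_inv {a a' b' b : ℝ} (ha : 0 < a) (haa : a < a') (hab : a' < b')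
    (hbb : b' < b) : ∃ h k : ℝ → ℝ, (∀ x, HasDerivAt h (-k x) x) ∧ Continuous k ∧ (∀ x, 0 ≤ k x) ∧
      (∀ x, b ≤ x → h x = 0) ∧ (∀ x, b ≤ x → k x = 0) ∧
      (∀ x ≤ a, 1 / a' - 1 / b' ≤ h x - x * k x) ∧
      (∀ x > a, -(1 / b' + 1 / a - 1 / a') ≤ h x - x * k x) := by
  obtain ⟨φ, h0, h1, h01⟩ := exists_continuous_zero_one_of_isClosed
    (s := (Ioo a b)ᶜ) (t := Icc a' b') isOpen_Ioo.isClosed_compl isClosed_Icc (by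
      rw [disjoint_compl_left_iff_subset]
      exact Icc_subset_Ioo haa hbb)
  have hφ0 : ∀ x, 0 ≤ φ x := fun x => (h01 x).1
  have hφ1 : ∀ x, φ x ≤ 1 := fun x => (h01 x).2
  have hmax : ∀ x, 0 < max x a := fun x => lt_max_of_lt_right ha
  -- The maximum only keeps the denominator positive: `φ` vanishes for `x ≤ a`, so `k` is `φ(x)/x²`
  -- wherever it is nonzero.
  set k : ℝ → ℝ := fun x => φ x / max x a ^ 2 with hkdef
  have hkc : Continuous k := by
    refine φ.continuous.div ((continuous_id.max continuous_const).pow 2) fun x => ?_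
    exact (pow_pos (hmax x) 2).ne'
  have hk0 : ∀ x, 0 ≤ k x := fun x => div_nonneg (hφ0 x) (sq_nonneg _)
  have hkb : ∀ x, b ≤ x → k x = 0 := fun x hx => by
    have : φ x = 0 := h0 (fun h => not_lt.2 hx h.2)
    simp [hkdef, this]
  have hka : ∀ x ≤ a, k x = 0 := fun x hx => by
    have : φ x = 0 := h0 (fun h => not_lt.2 hx h.1)
    simp [hkdef, this]
  have hii : ∀ x y, IntervalIntegrable k volume x y := fun x y => hkc.intervalIntegrable x y
  set h : ℝ → ℝ := fun x => ∫ t in x..b, k t with hhdef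
  have ha' : 0 < a' := ha.trans haa
  have hb' : 0 < b' := ha'.trans hab
  have hh0 : ∀ x ≤ b, 0 ≤ h x := fun x hx =>
    intervalIntegral.integral_nonneg hx fun t _ => hk0 t
  -- Discard the nonnegative contributions outside `[max x a', b']`, where `φ = 1` and `k` has
  -- primitive `-1/t`.
  have hlow : ∀ x ≤ b, 1 / max x a' - 1 / b' ≤ h x := by
    intro x hx
    rcases le_total (max x a') b' with hxb | hxb
    · have hpos : 0 < max x a' := lt_max_of_lt_right ha'
      have hint : ∫ t in (max x a')..b', k t = 1 / max x a' - 1 / b' := by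
        have hd : ∀ t ∈ uIcc (max x a') b', HasDerivAt (fun t : ℝ => -t⁻¹) (k t) t := by
          intro t ht
          rw [uIcc_of_le hxb] at ht
          have htpos : 0 < t := hpos.trans_le ht.1
          have e1 : φ t = 1 := h1 ⟨(le_max_right _ _).trans ht.1, ht.2⟩
          have e2 : max t a = t := max_eq_left (haa.le.trans ((le_max_right _ _).trans ht.1))
          have := (hasDerivAt_inv htpos.ne').neg
          simp only [hkdef, e1, e2]
          exact this.congr_deriv (by rw [neg_neg, one_div])
        rw [intervalIntegral.integral_eq_sub_of_hasDerivAt hd (hii _ _)]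
        simp only [one_div]
        ring
      rw [← hint]
      have e1 := intervalIntegral.integral_add_adjacent_intervals (hii x (max x a'))
        (hii (max x a') b')
      have e2 := intervalIntegral.integral_add_adjacent_intervals (hii x b') (hii b' b)
      have e3 : 0 ≤ ∫ t in x..(max x a'), k t :=
        intervalIntegral.integral_nonneg (le_max_left _ _) fun t _ => hk0 t
      have e4 : 0 ≤ ∫ t in b'..b, k t :=
        intervalIntegral.integral_nonneg hbb.le fun t _ => hk0 t
      simp only [hhdef]
      linarith
    · have := one_div_le_one_div_of_le hb' hxb
      linarith [hh0 x hx]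
  have hhb : ∀ x, b ≤ x → h x = 0 := by
    intro x hx
    simp only [hhdef]
    rw [intervalIntegral.integral_congr (g := fun _ => 0), intervalIntegral.integral_zero]
    intro t ht
    rw [uIcc_of_ge hx] at ht
    exact hkb t ht.1
  refine ⟨h, k, fun x => ?_, hkc, hk0, hhb, hkb, fun x hx => ?_, fun x hx => ?_⟩
  · exact intervalIntegral.integral_hasDerivAt_left (hii x b)
      hkc.stronglyMeasurable.stronglyMeasurableAtFilter hkc.continuousAt
  · have := hlow x (by linarith)
    rw [max_eq_right (by linarith)] at this
    rw [hka x hx]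
    linarith
  · have hx0 : 0 < x := ha.trans hx
    have haa' : 1 / a' ≤ 1 / a := one_div_le_one_div_of_le ha haa.le
    have hb0 : 0 < 1 / b' := by positivity
    rcases le_total b x with hbx | hbx
    · rw [hhb x hbx, hkb x hbx]
      linarith
    · have hxk : x * k x ≤ 1 / x := by
        simp only [hkdef, max_eq_left hx.le]
        rw [mul_div_assoc', div_le_div_iff₀ (by positivity) hx0]
        nlinarith [hφ1 x, mul_pos hx0 hx0]
      have := hlow x hbx
      -- The error `1/a - 1/a'` arises only on the transition interval `(a, a']`, where `h ≥ 1/a' -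
      -- 1/b'` and `x k(x) ≤ 1/x ≤ 1/a`.
      rcases le_total x a' with hxa | hxa
      · rw [max_eq_right hxa] at this
        have := one_div_le_one_div_of_le ha hx.le
        linarith
      · rw [max_eq_left hxa] at this
        linarith

namespace IsHolomorphicPiece

variable {D : Set (ℝ × ℝ)} {w : ℝ × ℝ → Cn n} {r : ℝ}

/-- The monotonicity formula for the area of a holomorphic curve in balls. -/
theorem monotonicity (hw : IsHolomorphicPiece D w r)
    (hE : IntegrableOn (fun z => ‖tauDeriv w z‖ ^ 2) D) {c : Cn n} (hcr : ∀ j, (c j).im = 0)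
    {ρ : ℝ} (hρ : 0 < ρ) (hc : ‖c‖ + ρ < r) {a : ℝ} (ha : 0 < a) (hab : a < ρ ^ 2) :
    1 / a * ∫ z in D ∩ {z | ‖w z - c‖ ^ 2 ≤ a}, ‖tauDeriv w z‖ ^ 2 ≤
      1 / ρ ^ 2 * ∫ z in D, ‖tauDeriv w z‖ ^ 2 := by
  set b := ρ ^ 2
  set S := D ∩ {z | ‖w z - c‖ ^ 2 ≤ a}
  have hSm : MeasurableSet S := by
    have : S = {z | z ∈ D ∧ ‖w z - c‖ ≤ Real.sqrt a} := by
      ext z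
      simp only [S, mem_inter_iff, mem_ofPred_eq, Real.le_sqrt (norm_nonneg _) ha.le]
    rw [this]
    refine (hw.isClosed_closedBall ?_).measurableSet
    have : Real.sqrt a ≤ ρ := Real.sqrt_le_iff.2 ⟨hρ.le, hab.le⟩
    linarith
  have hSD : S ⊆ D := inter_subset_left
  set mS := ∫ z in S, ‖tauDeriv w z‖ ^ 2
  set E := ∫ z in D, ‖tauDeriv w z‖ ^ 2
  -- The truncation with `a' = a + t` and `b' = b - t`. As `t → 0` the left side tends to `mS/a -
  -- E/b`.
  have hmain : ∀ t : ℝ, 0 < t → a + t < b - t →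
      (1 / (a + t) - 1 / (b - t)) * mS +
        (-(1 / (b - t) + 1 / a - 1 / (a + t))) * (E - mS) ≤ 0 := by
    intro t ht hat
    obtain ⟨h, k, hk, hkc, hk0, hhb, hkb, h1, h2⟩ := exists_truncated_inv ha
      (lt_add_of_pos_right a ht) hat (sub_lt_self b ht)
    obtain ⟨hI, hle⟩ := hw.integral_le_zero hE hcr hρ hc hk hkc hk0 hhb hkb
    have e1 := integral_inter_add_sdiff hSm hI
    rw [inter_eq_self_of_subset_right hSD] at e1
    have e2 := integral_inter_add_sdiff hSm hE
    rw [inter_eq_self_of_subset_right hSD] at e2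
    have e3 : E - mS = ∫ z in D \ S, ‖tauDeriv w z‖ ^ 2 := by
      change mS + _ = E at e2
      rw [← e2]
      ring
    rw [e3, ← integral_const_mul, ← integral_const_mul]
    have i1 : ∫ z in S, (1 / (a + t) - 1 / (b - t)) * ‖tauDeriv w z‖ ^ 2 ≤
        ∫ z in S, ‖tauDeriv w z‖ ^ 2 *
          (h (‖w z - c‖ ^ 2) - ‖w z - c‖ ^ 2 * k (‖w z - c‖ ^ 2)) := by
      refine setIntegral_mono_on ((hE.mono_set hSD).const_mul _) (hI.mono_set hSD) hSm ?_
      intro z hz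
      rw [mul_comm]
      exact mul_le_mul_of_nonneg_left (h1 _ hz.2) (by positivity)
    have i2 : ∫ z in D \ S, (-(1 / (b - t) + 1 / a - 1 / (a + t))) * ‖tauDeriv w z‖ ^ 2 ≤
        ∫ z in D \ S, ‖tauDeriv w z‖ ^ 2 *
          (h (‖w z - c‖ ^ 2) - ‖w z - c‖ ^ 2 * k (‖w z - c‖ ^ 2)) := by
      refine setIntegral_mono_on ((hE.mono_set sdiff_subset).const_mul _) (hI.mono_set sdiff_subset)
        (hw.measurableSet.diff hSm) ?_
      intro z hz
      rw [mul_comm]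
      exact mul_le_mul_of_nonneg_left (h2 _ (not_le.1 fun h => hz.2 ⟨hz.1, h⟩)) (by positivity)
    linarith
  have hlim : Tendsto (fun t : ℝ => (1 / (a + t) - 1 / (b - t)) * mS +
      (-(1 / (b - t) + 1 / a - 1 / (a + t))) * (E - mS)) (𝓝[>] 0)
      (𝓝 ((1 / (a + 0) - 1 / (b - 0)) * mS +
        (-(1 / (b - 0) + 1 / a - 1 / (a + 0))) * (E - mS))) := by
    have hb : b - 0 ≠ 0 := by linarith
    have ha' : a + 0 ≠ 0 := by linarith
    have : ContinuousAt (fun t : ℝ => (1 / (a + t) - 1 / (b - t)) * mS +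
      (-(1 / (b - t) + 1 / a - 1 / (a + t))) * (E - mS)) 0 := by
      fun_prop (disch := assumption)
    exact this.tendsto.mono_left nhdsWithin_le_nhds
  have := le_of_tendsto hlim (b := 0) (by
    filter_upwards [Ioo_mem_nhdsGT (show (0 : ℝ) < (b - a) / 2 by linarith)] with t ht
    exact hmain t ht.1 (by linarith [ht.2]))
  simp only [add_zero, sub_zero] at this
  linarith

end IsHolomorphicPiece

/-- A half-disc and its complex conjugate have equal area and together cover the disc. -/
theorem half_disc_volume (τ s : ℝ) (hs : 0 ≤ s) :
    Real.pi * s ^ 2 / 2 ≤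
      volume.real {z : ℝ × ℝ | 0 ≤ z.2 ∧ ‖(⟨z.1 - τ, z.2⟩ : ℂ)‖ ≤ s} := by
  have hball : volume.real (Metric.closedBall (0 : ℂ) s) = Real.pi * s ^ 2 := by
    rw [Measure.real, Complex.volume_closedBall]
    simp [hs]
    ring
  set T : Set ℂ := {ζ | 0 ≤ ζ.im ∧ ‖ζ‖ ≤ s}
  have hTm : MeasurableSet T :=
    ((isClosed_le continuous_const Complex.continuous_im).inter
      (isClosed_le continuous_norm continuous_const)).measurableSet
  have hTfin : volume T ≠ ⊤ := by
    refine ((measure_mono ?_).trans_lt (measure_closedBall_lt_top (x := (0 : ℂ)) (r := s))).ne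
    intro ζ hζ
    simpa using hζ.2
  have hconj : volume (Complex.conjLIE ⁻¹' T) = volume T :=
    (Complex.conjLIE.measurePreserving).measure_preimage hTm.nullMeasurableSet
  have hsub : Metric.closedBall (0 : ℂ) s ⊆ T ∪ Complex.conjLIE ⁻¹' T := by
    intro ζ hζ
    rw [mem_closedBall_zero_iff] at hζ
    rcases le_total 0 ζ.im with h | h
    · exact Or.inl ⟨h, hζ⟩
    · refine Or.inr ⟨?_, ?_⟩
      · simpa using h
      · simpa using hζ
  have h1 : Real.pi * s ^ 2 ≤ 2 * volume.real T := by
    rw [← hball]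
    refine (measureReal_mono hsub (measure_union_ne_top hTfin (hconj ▸ hTfin))).trans ?_
    refine (measureReal_union_le _ _).trans ?_
    simp only [Measure.real, hconj]
    linarith
  have h2 : volume {z : ℝ × ℝ | 0 ≤ z.2 ∧ ‖(⟨z.1 - τ, z.2⟩ : ℂ)‖ ≤ s} = volume T := by
    have e1 := Complex.volume_preserving_equiv_real_prod.symm.measure_preimage
      hTm.nullMeasurableSet
    rw [← e1, ← measure_preimage_add_right volume ((-τ, 0) : ℝ × ℝ)
      (Complex.measurableEquivRealProd.symm ⁻¹' T)]
    congr 1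
    ext z
    simp only [T, sub_eq_add_neg, mem_preimage, mem_ofPred_eq, Prod.fst_add, Prod.snd_add, add_zero,
      Complex.measurableEquivRealProd_symm_apply]
  rw [Measure.real, h2]
  change _ ≤ volume.real T
  linarith

namespace IsHolomorphicPiece

variable {D : Set (ℝ × ℝ)} {w : ℝ × ℝ → Cn n} {r : ℝ}

/-- On a half-disc of small radius `s`, `w` is nearly linear: it stays within `(A₀ + η)s` of `c`,
and `|∂_τ w| > A₀ - η`. Monotonicity is applied with `a = ((A₀ + η)s)²`, and `s` cancels. -/
theorem area_ge_of_tauDeriv_ne_zero_aux (hw : IsHolomorphicPiece D w r)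
    (hE : IntegrableOn (fun z => ‖tauDeriv w z‖ ^ 2) D) {τ : ℝ} (hτ : (τ, (0 : ℝ)) ∈ D)
    (hA : tauDeriv w (τ, 0) ≠ 0) {ρ : ℝ} (hρ : 0 < ρ) (hc : ‖w (τ, 0)‖ + ρ < r)
    {η : ℝ} (hη : 0 < η) (hηA : η < ‖tauDeriv w (τ, 0)‖) :
    1 / (‖tauDeriv w (τ, 0)‖ + η) ^ 2 * ((‖tauDeriv w (τ, 0)‖ - η) ^ 2 * (Real.pi / 2)) ≤
      1 / ρ ^ 2 * ∫ z in D, ‖tauDeriv w z‖ ^ 2 := by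
  set A₀ := ‖tauDeriv w (τ, 0)‖ with hA₀
  set c := w (τ, 0)
  have hA₀pos : 0 < A₀ := norm_pos_iff.2 hA
  have hev1 : ∀ᶠ z in 𝓝[strip] (τ, 0), A₀ - η < ‖tauDeriv w z‖ := by
    have h := ((hw.continuousOn_tauDeriv _ hτ).mono_of_mem_nhdsWithin (hw.mem_nhds _ hτ)).norm
    exact h.eventually (lt_mem_nhds (show A₀ - η < A₀ by linarith))
  have hev2 : ∀ᶠ z in 𝓝[strip] (τ, 0),
      ‖w z - c‖ ≤ (A₀ + η) * ‖(⟨z.1 - τ, z.2⟩ : ℂ)‖ := by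
    have h := (hw.hasFDerivWithinAt hτ).isLittleO.def hη
    filter_upwards [h] with z hz
    have e1 : z - ((τ, 0) : ℝ × ℝ) = (z.1 - τ, z.2) := by ext <;> simp
    rw [e1, complexSmul_apply] at hz
    have e2 : ‖((z.1 - τ, z.2) : ℝ × ℝ)‖ ≤ ‖(⟨z.1 - τ, z.2⟩ : ℂ)‖ := by
      refine max_le ?_ ?_
      · exact Complex.abs_re_le_norm ⟨z.1 - τ, z.2⟩
      · exact Complex.abs_im_le_norm ⟨z.1 - τ, z.2⟩
    have e3 := norm_le_norm_add_norm_sub' (w z - c)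
      ((⟨z.1 - τ, z.2⟩ : ℂ) • tauDeriv w (τ, 0))
    rw [norm_smul, ← hA₀] at e3
    nlinarith
  obtain ⟨ε, hε, hball⟩ := Metric.mem_nhdsWithin_iff.1
    (inter_mem (hw.mem_nhds _ hτ) (inter_mem hev1 hev2))
  obtain ⟨s, hs0, hs⟩ : ∃ s : ℝ, 0 < s ∧ s < ε ∧ s < 1 ∧ (A₀ + η) * s < ρ := by
    have h1 : ∀ᶠ s : ℝ in 𝓝[>] 0, s < ε := nhdsWithin_le_nhds (gt_mem_nhds hε)
    have h2 : ∀ᶠ s : ℝ in 𝓝[>] 0, s < 1 := nhdsWithin_le_nhds (gt_mem_nhds one_pos)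
    have h3 : ∀ᶠ s : ℝ in 𝓝[>] 0, (A₀ + η) * s < ρ := by
      have : ContinuousAt (fun s : ℝ => (A₀ + η) * s) 0 := by fun_prop
      exact nhdsWithin_le_nhds (this.eventually_lt_const (by simpa using hρ))
    obtain ⟨s, h4, h5⟩ := ((h1.and (h2.and h3)).and self_mem_nhdsWithin).exists
    exact ⟨s, h5, h4⟩
  obtain ⟨hsε, hs1, hsρ⟩ := hs
  set T : Set (ℝ × ℝ) := {z | 0 ≤ z.2 ∧ ‖(⟨z.1 - τ, z.2⟩ : ℂ)‖ ≤ s}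
  have hT : ∀ z ∈ T, z ∈ D ∧ A₀ - η < ‖tauDeriv w z‖ ∧ ‖w z - c‖ ≤ (A₀ + η) * s := by
    rintro z ⟨h0, h1⟩
    have hre : |z.1 - τ| ≤ s := (Complex.abs_re_le_norm ⟨z.1 - τ, z.2⟩).trans h1
    have him : |z.2| ≤ s := (Complex.abs_im_le_norm ⟨z.1 - τ, z.2⟩).trans h1
    have hz : z ∈ Metric.ball ((τ, 0) : ℝ × ℝ) ε ∩ strip := by
      refine ⟨?_, mem_strip.2 ⟨h0, (le_abs_self _).trans (him.trans hs1.le)⟩⟩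
      rw [Metric.mem_ball, Prod.dist_eq, Real.dist_eq, Real.dist_eq, sub_zero]
      exact max_lt (hre.trans_lt hsε) (him.trans_lt hsε)
    obtain ⟨h2, h3, h4⟩ := hball hz
    exact ⟨h2, h3, le_trans h4 (mul_le_mul_of_nonneg_left h1 (by positivity))⟩
  have hTm : MeasurableSet T := by
    have hcont : Continuous fun z : ℝ × ℝ => (⟨z.1 - τ, z.2⟩ : ℂ) := by
      have := Complex.equivRealProdCLM.symm.continuous.comp
        (show Continuous fun z : ℝ × ℝ => (z.1 - τ, z.2) by fun_prop)
      exact this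
    exact ((isClosed_le continuous_const continuous_snd).inter
      (isClosed_le hcont.norm continuous_const)).measurableSet
  have hTfin : volume T ≠ ⊤ := by
    refine ((measure_mono ?_).trans_lt
      (measure_closedBall_lt_top (x := ((τ, 0) : ℝ × ℝ)) (r := s))).ne
    rintro z ⟨h0, h1⟩
    have hre : |z.1 - τ| ≤ s := (Complex.abs_re_le_norm ⟨z.1 - τ, z.2⟩).trans h1
    have him : |z.2| ≤ s := (Complex.abs_im_le_norm ⟨z.1 - τ, z.2⟩).trans h1
    rw [Metric.mem_closedBall, Prod.dist_eq, Real.dist_eq, Real.dist_eq, sub_zero]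
    exact max_le hre him
  set a := ((A₀ + η) * s) ^ 2
  have hapos : 0 < a := by positivity
  have hmono := hw.monotonicity hE (hw.real τ hτ) hρ hc hapos
    (pow_lt_pow_left₀ hsρ (by positivity) two_ne_zero)
  refine le_trans ?_ hmono
  have hTS : T ⊆ D ∩ {z | ‖w z - c‖ ^ 2 ≤ a} := fun z hz =>
    ⟨(hT z hz).1, pow_le_pow_left₀ (norm_nonneg _) (hT z hz).2.2 2⟩
  have h1 : (A₀ - η) ^ 2 * (Real.pi * s ^ 2 / 2) ≤
      ∫ z in D ∩ {z | ‖w z - c‖ ^ 2 ≤ a}, ‖tauDeriv w z‖ ^ 2 := by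
    calc (A₀ - η) ^ 2 * (Real.pi * s ^ 2 / 2) ≤ (A₀ - η) ^ 2 * volume.real T :=
          mul_le_mul_of_nonneg_left (half_disc_volume τ s hs0.le) (sq_nonneg _)
      _ = ∫ z in T, (A₀ - η) ^ 2 := by rw [setIntegral_const, smul_eq_mul, mul_comm]
      _ ≤ ∫ z in T, ‖tauDeriv w z‖ ^ 2 := by
          refine setIntegral_mono_on (integrableOn_const hTfin)
            (hE.mono_set fun z hz => (hT z hz).1) hTm fun z hz => ?_
          exact pow_le_pow_left₀ (by linarith) (hT z hz).2.1.le 2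
      _ ≤ _ := by
          refine setIntegral_mono_set (hE.mono_set inter_subset_left)
            (Eventually.of_forall fun z => by positivity) hTS.eventuallyLE
  calc _ = 1 / a * ((A₀ - η) ^ 2 * (Real.pi * s ^ 2 / 2)) := by
        simp only [a]
        have : A₀ + η ≠ 0 := by positivity
        field_simp
    _ ≤ _ := mul_le_mul_of_nonneg_left h1 (by positivity)

/-- The area of a holomorphic curve through the point `c` of the ball is at least half of the area
of a flat disc of radius `r - |c|`. -/
theorem area_ge_of_tauDeriv_ne_zero (hw : IsHolomorphicPiece D w r)
    (hE : IntegrableOn (fun z => ‖tauDeriv w z‖ ^ 2) D) {τ : ℝ} (hτ : (τ, (0 : ℝ)) ∈ D)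
    (hA : tauDeriv w (τ, 0) ≠ 0) (hr : ‖w (τ, 0)‖ < r) :
    Real.pi * (r - ‖w (τ, 0)‖) ^ 2 / 2 ≤ ∫ z in D, ‖tauDeriv w z‖ ^ 2 := by
  have hA₀pos : 0 < ‖tauDeriv w (τ, 0)‖ := norm_pos_iff.2 hA
  set A₀ := ‖tauDeriv w (τ, 0)‖
  set c := w (τ, 0)
  have key : ∀ ρ : ℝ, 0 < ρ → ‖c‖ + ρ < r →
      Real.pi * ρ ^ 2 / 2 ≤ ∫ z in D, ‖tauDeriv w z‖ ^ 2 := by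
    intro ρ hρ hc
    have hlim : Tendsto (fun η : ℝ => 1 / (A₀ + η) ^ 2 * ((A₀ - η) ^ 2 * (Real.pi / 2))) (𝓝[>] 0)
        (𝓝 (1 / (A₀ + 0) ^ 2 * ((A₀ - 0) ^ 2 * (Real.pi / 2)))) := by
      have h0 : (A₀ + 0) ^ 2 ≠ 0 := by positivity
      have : ContinuousAt (fun η : ℝ => 1 / (A₀ + η) ^ 2 * ((A₀ - η) ^ 2 * (Real.pi / 2))) 0 := by
        fun_prop (disch := assumption)
      exact this.tendsto.mono_left nhdsWithin_le_nhds
    have h := le_of_tendsto hlim (b := 1 / ρ ^ 2 * ∫ z in D, ‖tauDeriv w z‖ ^ 2) (by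
      filter_upwards [Ioo_mem_nhdsGT hA₀pos] with η hη
      exact hw.area_ge_of_tauDeriv_ne_zero_aux hE hτ hA hρ hc hη.1 hη.2)
    have e1 : 1 / (A₀ + 0) ^ 2 * ((A₀ - 0) ^ 2 * (Real.pi / 2)) = Real.pi / 2 := by
      simp only [add_zero, sub_zero]
      field_simp
    rw [e1, one_div, inv_mul_eq_div, le_div_iff₀ (by positivity)] at h
    linarith
  have hlim : Tendsto (fun ρ : ℝ => Real.pi * ρ ^ 2 / 2) (𝓝[<] (r - ‖c‖))
      (𝓝 (Real.pi * (r - ‖c‖) ^ 2 / 2)) := by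
    have : Continuous fun ρ : ℝ => Real.pi * ρ ^ 2 / 2 := by fun_prop
    exact this.continuousAt.tendsto.mono_left nhdsWithin_le_nhds
  refine le_of_tendsto hlim ?_
  filter_upwards [Ioo_mem_nhdsLT (sub_pos.2 hr)] with ρ hρ
  exact key ρ hρ.1 (by linarith [hρ.2])

end IsHolomorphicPiece

end

/-! ### Unique continuation and the area bound through the centre -/

section

variable {n : ℕ}

namespace IsHolomorphicPiece

variable {D : Set (ℝ × ℝ)} {w : ℝ × ℝ → Cn n} {r : ℝ}

/-- The zero set of `w` in `D` is closed in the plane, by properness at level `0`. The identity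
theorem spreads its interior over the whole open strip; closedness then yields a zero on the top
edge, which `D` avoids. -/
theorem not_eventually_eq_zero (hw : IsHolomorphicPiece D w r) (hr : 0 < r)
    (h0 : ((0, 0) : ℝ × ℝ) ∈ D) : ¬ ∀ᶠ z in 𝓝[strip] (0, 0), w z = 0 := by
  intro hev
  set F := fun ζ : ℂ => w (ζ.re, ζ.im)
  have hpair : Continuous fun ζ : ℂ => (ζ.re, ζ.im) := by fun_prop
  set K : Set ℂ := {ζ | (ζ.re, ζ.im) ∈ D ∧ ‖w (ζ.re, ζ.im)‖ ≤ 0}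
  have hK : IsClosed K := (hw.isClosed 0 hr).preimage hpair
  set O : Set ℂ := {ζ | 0 < ζ.im ∧ ζ.im < 1}
  have hOc : Convex ℝ O := (convex_halfSpace_im_gt 0).inter (convex_halfSpace_im_lt 1)
  have hlim : ∀ a : ℝ, Tendsto (fun t : ℝ => (⟨0, t⟩ : ℂ)) (𝓝 a) (𝓝 ⟨0, a⟩) := fun a =>
    (Complex.equivRealProdCLM.symm.continuous.comp
      (show Continuous fun t : ℝ => ((0 : ℝ), t) by fun_prop)).tendsto a
  have hsub : O ⊆ interior K := by
    refine hOc.isPreconnected.subset_of_closure_inter_subset isOpen_interior ?_ ?_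
    · obtain ⟨ε, hε, hball⟩ := Metric.mem_nhdsWithin_iff.1 (inter_mem (hw.mem_nhds _ h0) hev)
      have hW : {ζ : ℂ | ‖ζ‖ < ε ∧ 0 < ζ.im ∧ ζ.im < 1} ⊆ K := by
        rintro ζ ⟨h1, h2, h3⟩
        have hmem : ((ζ.re, ζ.im) : ℝ × ℝ) ∈ Metric.ball ((0, 0) : ℝ × ℝ) ε := by
          rw [Metric.mem_ball, Prod.dist_eq, Real.dist_eq, Real.dist_eq, sub_zero, sub_zero]
          exact max_lt ((Complex.abs_re_le_norm ζ).trans_lt h1)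
            ((Complex.abs_im_le_norm ζ).trans_lt h1)
        have := hball ⟨hmem, mem_strip.2 ⟨h2.le, h3.le⟩⟩
        exact ⟨this.1, by rw [show w (ζ.re, ζ.im) = 0 from this.2, norm_zero]⟩
      have hWo : IsOpen {ζ : ℂ | ‖ζ‖ < ε ∧ 0 < ζ.im ∧ ζ.im < 1} :=
        (isOpen_lt continuous_norm continuous_const).inter
          ((isOpen_lt continuous_const Complex.continuous_im).inter
            (isOpen_lt Complex.continuous_im continuous_const))
      have hm : 0 < min ε 1 := lt_min hε one_pos
      have h1 : (⟨0, min ε 1 / 2⟩ : ℂ) ∈ {ζ : ℂ | ‖ζ‖ < ε ∧ 0 < ζ.im ∧ ζ.im < 1} := by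
        refine ⟨?_, half_pos hm, (half_lt_self hm).trans_le (min_le_right _ _)⟩
        refine (Complex.norm_le_abs_re_add_abs_im _).trans_lt ?_
        simp only [abs_zero, zero_add]
        rw [abs_of_pos (half_pos hm)]
        exact (half_lt_self hm).trans_le (min_le_left _ _)
      exact ⟨_, h1.2, interior_maximal hW hWo h1⟩
    -- A limit of interior zeros lies in `K`, hence in `D`, so `w` is holomorphic on a small ball
    -- around it and vanishes there.
    · rintro ζ ⟨hζ, hζO⟩
      have hζK : ζ ∈ K := hK.closure_subset_iff.2 interior_subset hζ
      obtain ⟨ε, hε, hball⟩ := Metric.isOpen_iff.1 hw.isOpen_complex ζ ⟨hζK.1, hζO.1, hζO.2⟩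
      have hd : DifferentiableOn ℂ F (Metric.ball ζ ε) := fun y hy =>
        (hw.hasDerivAt (hball hy).1 (hball hy).2.1
          (hball hy).2.2).differentiableAt.differentiableWithinAt
      obtain ⟨y, hy, hyK⟩ := mem_closure_iff.1 hζ _ Metric.isOpen_ball (Metric.mem_ball_self hε)
      have hF : F =ᶠ[𝓝 y] 0 := by
        filter_upwards [isOpen_interior.mem_nhds hyK] with x hx
        exact norm_le_zero_iff.1 (interior_subset hx).2
      have hEq := (hd.analyticOnNhd Metric.isOpen_ball).eqOn_zero_of_preconnected_of_eventuallyEq_zero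
        (convex_ball ζ ε).isPreconnected hy hF
      have hBK : Metric.ball ζ ε ⊆ K := fun x hx => ⟨(hball hx).1, norm_le_zero_iff.2 (hEq hx)⟩
      exact interior_maximal hBK Metric.isOpen_ball (Metric.mem_ball_self hε)
  have h1 : (⟨0, 1⟩ : ℂ) ∈ K := by
    refine hK.mem_of_frequently_of_tendsto (b := 𝓝[<] (1 : ℝ)) (Eventually.frequently ?_)
      ((hlim 1).mono_left nhdsWithin_le_nhds)
    filter_upwards [Ioo_mem_nhdsLT (zero_lt_one (α := ℝ))] with t ht
    exact interior_subset (hsub ht)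
  exact hw.top 0 h1.1

theorem eventually_eq_zero_of_tauDeriv_eq_zero (hw : IsHolomorphicPiece D w r)
    (h0 : ((0, 0) : ℝ × ℝ) ∈ D) (hw0 : w (0, 0) = 0)
    (hA : ∀ᶠ τ : ℝ in 𝓝 0, tauDeriv w (τ, 0) = 0) : ∀ᶠ z in 𝓝[strip] (0, 0), w z = 0 := by
  obtain ⟨ε₁, hε₁, hball⟩ := Metric.mem_nhdsWithin_iff.1 (hw.mem_nhds _ h0)
  obtain ⟨ε₂, hε₂, hball₂⟩ := Metric.eventually_nhds_iff.1 hA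
  set ε := min (min ε₁ ε₂) 1
  have hε : 0 < ε := lt_min (lt_min hε₁ hε₂) one_pos
  have hε1 : ε ≤ 1 := min_le_right _ _
  have hD : ∀ x y : ℝ, |x| < ε → 0 ≤ y → y < ε → (x, y) ∈ D := by
    intro x y hx hy hyε
    refine hball ⟨?_, mem_strip.2 ⟨hy, by linarith⟩⟩
    rw [Metric.mem_ball, Prod.dist_eq, Real.dist_eq, Real.dist_eq, sub_zero, sub_zero]
    have : ε ≤ ε₁ := (min_le_left _ _).trans (min_le_left _ _)
    exact max_lt (by linarith) (by rw [abs_of_nonneg hy]; linarith)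
  have hA0 : ∀ x : ℝ, |x| < ε → tauDeriv w (x, 0) = 0 := by
    intro x hx
    refine hball₂ ?_
    rw [Real.dist_eq, sub_zero]
    exact hx.trans_le ((min_le_left _ _).trans (min_le_right _ _))
  have hline : ∀ x : ℝ, |x| < ε → w (x, 0) = 0 := by
    have hd : ∀ x ∈ Metric.ball (0 : ℝ) ε, HasDerivAt (fun x : ℝ => w (x, 0)) 0 x := by
      intro x hx
      rw [mem_ball_zero_iff, Real.norm_eq_abs] at hx
      have h1 := hw.hasFDerivWithinAt (hD x 0 hx le_rfl hε)
      have h2 : HasDerivAt (fun s : ℝ => (s, (0 : ℝ))) (1, 0) x :=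
        (hasDerivAt_id x).prodMk (hasDerivAt_const _ _)
      have := h1.comp_hasDerivAt x h2 (Eventually.of_forall fun s => by simp [mem_strip])
      rwa [complexSmul_apply, hA0 x hx, smul_zero] at this
    intro x hx
    rw [← hw0]
    exact Metric.isOpen_ball.is_const_of_deriv_eq_zero (convex_ball (0 : ℝ) ε).isPreconnected
      (fun y hy => (hd y hy).differentiableAt.differentiableWithinAt)
      (fun y hy => (hd y hy).deriv) (by simpa using hx) (Metric.mem_ball_self hε)
  -- Since `w` and its derivative vanish on the real segment, extension by zero below it is complex
  -- differentiable across it; the identity theorem then starts from a point of the lower half-disc.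
  set W : ℂ → Cn n := fun ζ => if 0 ≤ ζ.im then w (ζ.re, ζ.im) else 0
  have hre : ∀ ζ ∈ Metric.ball (0 : ℂ) ε, |ζ.re| < ε := fun ζ hζ =>
    (Complex.abs_re_le_norm ζ).trans_lt (mem_ball_zero_iff.1 hζ)
  have him : ∀ ζ ∈ Metric.ball (0 : ℂ) ε, ζ.im < ε := fun ζ hζ =>
    ((le_abs_self _).trans (Complex.abs_im_le_norm ζ)).trans_lt (mem_ball_zero_iff.1 hζ)
  have hneg : ∀ ζ : ℂ, ζ.im < 0 → W ζ = 0 := fun ζ h => if_neg (not_le.2 h)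
  have hWd : DifferentiableOn ℂ W (Metric.ball 0 ε) := by
    intro ζ hζ
    refine DifferentiableAt.differentiableWithinAt ?_
    rcases lt_trichotomy ζ.im 0 with h | h | h
    · refine (differentiableAt_const (0 : Cn n)).congr_of_eventuallyEq ?_
      filter_upwards [Complex.continuous_im.continuousAt.eventually_lt_const h] with y hy
      exact hneg y hy
    · have hW0 : W ζ = 0 := by
        simp only [W, h, le_refl, if_true]
        exact hline _ (hre ζ hζ)
      have h1 : HasFDerivWithinAt W (0 : ℂ →L[ℝ] Cn n) {y | 0 ≤ y.im ∧ y.im ≤ 1} ζ := by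
        have e1 := hw.hasFDerivWithinAt (hD ζ.re ζ.im (hre ζ hζ) h.ge (him ζ hζ))
        have e2 : HasFDerivAt (fun ζ : ℂ => (ζ.re, ζ.im)) (Complex.reCLM.prod Complex.imCLM) ζ :=
          Complex.reCLM.hasFDerivAt.prodMk Complex.imCLM.hasFDerivAt
        have e3 := HasFDerivWithinAt.comp ζ e1 (e2.hasFDerivWithinAt
          (s := {y : ℂ | 0 ≤ y.im ∧ y.im ≤ 1})) fun y hy => mem_strip.2 hy
        have e4 : tauDeriv w (ζ.re, ζ.im) = 0 := by
          rw [h]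
          exact hA0 _ (hre ζ hζ)
        have e5 : (complexSmul (tauDeriv w (ζ.re, ζ.im))).comp
            (Complex.reCLM.prod Complex.imCLM) = 0 := by
          refine ContinuousLinearMap.ext fun y => ?_
          simp [complexSmul_apply, e4]
        rw [e5] at e3
        exact e3.congr (fun y hy => if_pos hy.1) (if_pos h.ge)
      have h2 : HasFDerivWithinAt W (0 : ℂ →L[ℝ] Cn n) {y | y.im < 0} ζ :=
        (hasFDerivWithinAt_const (0 : Cn n) ζ _).congr (fun y hy => hneg y hy) hW0
      have h3 : HasFDerivAt W (0 : ℂ →L[ℝ] Cn n) ζ := by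
        refine (h1.union h2).hasFDerivAt ?_
        filter_upwards [Complex.continuous_im.continuousAt.eventually_lt_const
          (show ζ.im < 1 by rw [h]; exact one_pos)] with y hy
        rcases lt_or_ge y.im 0 with h4 | h4
        · exact Or.inr h4
        · exact Or.inl ⟨h4, hy.le⟩
      exact (hasFDerivAt_of_restrictScalars ℝ h3
        (f' := (0 : ℂ →L[ℂ] Cn n)) rfl).differentiableAt
    · have h1 := hw.hasDerivAt (hD ζ.re ζ.im (hre ζ hζ) h.le (him ζ hζ)) h
        ((him ζ hζ).trans_le hε1)
      refine h1.differentiableAt.congr_of_eventuallyEq ?_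
      filter_upwards [Complex.continuous_im.continuousAt.eventually_const_lt h] with y hy
      exact if_pos hy.le
  have hEq := (hWd.analyticOnNhd Metric.isOpen_ball).eqOn_zero_of_preconnected_of_eventuallyEq_zero
    (convex_ball (0 : ℂ) ε).isPreconnected (z₀ := ⟨0, -(ε / 2)⟩)
    (by
      rw [mem_ball_zero_iff]
      refine (Complex.norm_le_abs_re_add_abs_im _).trans_lt ?_
      simp only [abs_zero, zero_add, abs_neg]
      rw [abs_of_pos (half_pos hε)]
      exact half_lt_self hε)
    (by
      filter_upwards [Complex.continuous_im.continuousAt.eventually_lt_const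
        (show (⟨0, -(ε / 2)⟩ : ℂ).im < 0 by simpa using hε)] with y hy
      exact hneg y hy)
  refine Metric.mem_nhdsWithin_iff.2 ⟨ε / 2, half_pos hε, ?_⟩
  rintro z ⟨hz, hzs⟩
  rw [Metric.mem_ball, Prod.dist_eq, Real.dist_eq, Real.dist_eq, sub_zero, sub_zero,
    max_lt_iff] at hz
  have h1 : W ⟨z.1, z.2⟩ = 0 := hEq (by
    rw [mem_ball_zero_iff]
    refine (Complex.norm_le_abs_re_add_abs_im _).trans_lt ?_
    simp only
    linarith)
  change w z = 0
  simpa only [W, (mem_strip.1 hzs).1, if_true] using h1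

/-- The area of a holomorphic half-disc through the centre of the ball. -/
theorem area_ge (hw : IsHolomorphicPiece D w r)
    (hE : IntegrableOn (fun z => ‖tauDeriv w z‖ ^ 2) D) (hr : 0 < r)
    (h0 : ((0, 0) : ℝ × ℝ) ∈ D) (hw0 : w (0, 0) = 0) :
    Real.pi * r ^ 2 / 2 ≤ ∫ z in D, ‖tauDeriv w z‖ ^ 2 := by
  have hfreq : ∃ᶠ τ : ℝ in 𝓝 0, tauDeriv w (τ, 0) ≠ 0 := fun h =>
    hw.not_eventually_eq_zero hr h0
      (hw.eventually_eq_zero_of_tauDeriv_eq_zero h0 hw0 (by simpa using h))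
  have hcs : Tendsto (fun τ : ℝ => (τ, (0 : ℝ))) (𝓝 0) (𝓝[strip] (0, 0)) :=
    tendsto_nhdsWithin_iff.2 ⟨(show Continuous fun τ : ℝ => (τ, (0 : ℝ)) by fun_prop).tendsto 0,
      Eventually.of_forall fun s => by simp [mem_strip]⟩
  have hcw : Tendsto (fun τ : ℝ => ‖w (τ, 0)‖) (𝓝 0) (𝓝 0) := by
    have := ((hw.contDiff _ h0).continuousWithinAt.tendsto.comp hcs).norm
    rwa [hw0, norm_zero] at this
  have hlim : Tendsto (fun τ : ℝ => Real.pi * (r - ‖w (τ, 0)‖) ^ 2 / 2) (𝓝 0)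
      (𝓝 (Real.pi * (r - 0) ^ 2 / 2)) :=
    ((hcw.const_sub r).pow 2 |>.const_mul Real.pi).div_const 2
  rw [sub_zero] at hlim
  -- Noncritical points need only accumulate at `0`.
  refine le_of_tendsto_of_frequently hlim ?_
  refine (hfreq.and_eventually ((hcs.eventually_mem (hw.mem_nhds _ h0)).and
    (hcw.eventually (gt_mem_nhds hr)))).mono ?_
  rintro τ ⟨h1, h2, h3⟩
  exact hw.area_ge_of_tauDeriv_ne_zero hE h2 h1 h3

end IsHolomorphicPiece

end

/-! ### Local inverses of the Darboux embedding and derivatives in charts -/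

section

variable {n : ℕ} {M : Type*} [TopologicalSpace M] [ChartedSpace (Model n) M]

/-- All tangent spaces are definitionally the model space, so vectors move between equal base points
without casts. -/
theorem TwoForm.congr_point (Ω : TwoForm n M) {x y : M} (h : x = y) (a b : Model n) :
    Ω x ![a, b] = Ω y ![a, b] := by
  subst h; rfl

theorem EndField.congr_point (J : EndField n M) {x y : M} (h : x = y) (a : Model n) :
    (J x a : Model n) = J y a := by
  subst h; rfl

theorem stdForm_I_smul (a : Cn n) : stdForm a (Complex.I • a) = ‖a‖ ^ 2 := by
  rw [EuclideanSpace.norm_sq_eq, stdForm]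
  refine Finset.sum_congr rfl fun j _ => ?_
  rw [Complex.sq_norm, Complex.normSq_apply]
  simp

theorem uniqueMDiffWithinAt_strip {z : ℝ × ℝ} (hz : z ∈ strip) :
    UniqueMDiffWithinAt 𝓘(ℝ, ℝ × ℝ) strip z :=
  (uniqueDiffOn_strip z hz).uniqueMDiffWithinAt

/-- A kernel vector `u` pairs to zero with everything under the pulled-back form, yet pairs with `i
u` to `|u|²`. -/
theorem IsSymplecticEmbedding.ballDeriv_injective {Ω : TwoForm n M} {e : Cn n → M} {r : ℝ}
    (he : IsSymplecticEmbedding Ω e r) {ζ : Cn n}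
    (hζ : ζ ∈ Metric.closedBall (0 : Cn n) r) : Function.Injective (ballDeriv e r ζ) := by
  rw [injective_iff_map_eq_zero]
  intro u hu
  have h := he.pullback ζ hζ u (Complex.I • u)
  rw [stdForm_I_smul, hu] at h
  have h0 : Ω (e ζ) ![0, ballDeriv e r ζ (Complex.I • u)] = 0 :=
    (Ω (e ζ)).map_coord_zero 0 rfl
  rw [h0] at h
  exact norm_eq_zero.1 (pow_eq_zero_iff two_ne_zero |>.1 h.symm)

variable [IsManifold (𝓡 (2 * n)) ∞ M]

theorem finrank_Cn : Module.finrank ℝ (Cn n) = 2 * n := by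
  rw [← Module.finrank_mul_finrank ℝ ℂ (Cn n)]
  simp [Complex.finrank_real_complex]

namespace IsSymplecticEmbedding

variable {Ω : TwoForm n M} {e : Cn n → M} {r : ℝ}

/-- A symplectic embedding of the ball has smooth local inverses at interior points. -/
theorem exists_local_inverse (he : IsSymplecticEmbedding Ω e r) {ζ : Cn n} (hζ : ‖ζ‖ < r) :
    ∃ G : M → Cn n, G (e ζ) = ζ ∧ ContMDiffAt (𝓡 (2 * n)) 𝓘(ℝ, Cn n) ∞ G (e ζ) ∧
      ∀ᶠ x in 𝓝 (e ζ), e (G x) = x := by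
  have hnhds : Metric.closedBall (0 : Cn n) r ∈ 𝓝 ζ :=
    Metric.closedBall_mem_nhds_of_mem (mem_ball_zero_iff.2 hζ)
  have hζc : ζ ∈ Metric.closedBall (0 : Cn n) r := mem_of_mem_nhds hnhds
  have hes : ContMDiffAt 𝓘(ℝ, Cn n) (𝓡 (2 * n)) ∞ e ζ := he.smooth.contMDiffAt hnhds
  set ψ := extChartAt (𝓡 (2 * n)) (e ζ) with hψ
  set f : Cn n → Model n := ψ ∘ e
  have hψs : ContMDiffAt (𝓡 (2 * n)) 𝓘(ℝ, Model n) ∞ ψ (e ζ) := contMDiffAt_extChartAt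
  have hf : ContDiffAt ℝ ∞ f ζ := (hψs.comp ζ hes).contDiffAt
  have hfd : HasFDerivAt f (fderiv ℝ f ζ) ζ := (hf.differentiableAt (by simp)).hasFDerivAt
  have hfc : ∀ u, fderiv ℝ f ζ u =
      mfderiv (𝓡 (2 * n)) 𝓘(ℝ, Model n) ψ (e ζ) (ballDeriv e r ζ u) := by
    intro u
    rw [ballDeriv, mfderivWithin_of_mem_nhds hnhds, ← mfderiv_eq_fderiv,
      mfderiv_comp ζ (hψs.mdifferentiableAt (by simp)) (hes.mdifferentiableAt (by simp))]
    rfl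
  have hinv := isInvertible_mfderiv_extChartAt (I := 𝓡 (2 * n)) (mem_extChartAt_source (e ζ))
  have hinj : Function.Injective (fderiv ℝ f ζ) := by
    intro u u' h
    rw [hfc, hfc] at h
    exact he.ballDeriv_injective hζc (hinv.injective h)
  -- Injectivity and equality of dimensions give the isomorphism required by the inverse function
  -- theorem.
  set f' : Cn n ≃L[ℝ] Model n := (LinearEquiv.ofInjectiveOfFinrankEq
    (fderiv ℝ f ζ : Cn n →ₗ[ℝ] Model n) hinj (by rw [finrank_Cn]; simp)).toContinuousLinearEquiv
  have hf' : HasFDerivAt f (f' : Cn n →L[ℝ] Model n) ζ := by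
    refine hfd.congr_fderiv ?_
    ext1 u
    rfl
  have hne : (∞ : WithTop ℕ∞) ≠ 0 := by simp
  set g := hf.localInverse hf' hne
  have hg0 : g (f ζ) = ζ := hf.localInverse_apply_image hf' hne
  have hgs : ContDiffAt ℝ ∞ g (f ζ) := hf.to_localInverse hf' hne
  have hgr : ∀ᶠ y in 𝓝 (f ζ), f (g y) = y :=
    (hf.hasStrictFDerivAt' hf' hne).eventually_right_inverse
  have hGs : ContMDiffAt (𝓡 (2 * n)) 𝓘(ℝ, Cn n) ∞ (g ∘ ψ) (e ζ) :=
    ContMDiffAt.comp (e ζ) (show ContMDiffAt 𝓘(ℝ, Model n) 𝓘(ℝ, Cn n) ∞ g (ψ (e ζ)) from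
      hgs.contMDiffAt) hψs
  refine ⟨g ∘ ψ, hg0, hGs, ?_⟩
  have hsrc : ψ.source ∈ 𝓝 (e ζ) := extChartAt_source_mem_nhds (e ζ)
  have hGe : ContinuousAt (fun x => e (g (ψ x))) (e ζ) :=
    ContinuousAt.comp (g := e) (f := g ∘ ψ)
      (by rw [show (g ∘ ψ) (e ζ) = ζ from hg0]; exact hes.continuousAt) hGs.continuousAt
  have h1 : ∀ᶠ x in 𝓝 (e ζ), e (g (ψ x)) ∈ ψ.source := by
    refine hGe.eventually_mem ?_
    rw [show g (ψ (e ζ)) = ζ from hg0]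
    exact hsrc
  filter_upwards [hsrc, h1, hψs.continuousAt.eventually hgr] with x hx hx1 hx2
  exact ψ.injOn hx1 hx hx2

end IsSymplecticEmbedding

/-- The differential of a map of the strip, read in a chart. -/
theorem mfderivWithin_strip_eq {v : ℝ × ℝ → M}
    (hv : ContMDiffOn 𝓘(ℝ, ℝ × ℝ) (𝓡 (2 * n)) ∞ v strip) (x₀ : M) {z : ℝ × ℝ} (hz : z ∈ strip)
    (hvz : v z ∈ (extChartAt (𝓡 (2 * n)) x₀).source) (y : ℝ × ℝ) :
    (mfderivWithin 𝓘(ℝ, ℝ × ℝ) (𝓡 (2 * n)) v strip z y : Model n) =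
      mfderiv 𝓘(ℝ, Model n) (𝓡 (2 * n)) (extChartAt (𝓡 (2 * n)) x₀).symm
        (extChartAt (𝓡 (2 * n)) x₀ (v z))
        (fderivWithin ℝ (extChartAt (𝓡 (2 * n)) x₀ ∘ v) strip z y) := by
  have hu := uniqueMDiffWithinAt_strip hz
  have hsrc : v z ∈ (chartAt (Model n) x₀).source := by
    rwa [extChartAt_source] at hvz
  have h1 : mfderivWithin 𝓘(ℝ, ℝ × ℝ) 𝓘(ℝ, Model n) (extChartAt (𝓡 (2 * n)) x₀ ∘ v) strip z =
      (mfderiv (𝓡 (2 * n)) 𝓘(ℝ, Model n) (extChartAt (𝓡 (2 * n)) x₀) (v z)).comp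
        (mfderivWithin 𝓘(ℝ, ℝ × ℝ) (𝓡 (2 * n)) v strip z) :=
    mfderiv_comp_mfderivWithin z (mdifferentiableAt_extChartAt hsrc)
      ((hv z hz).mdifferentiableWithinAt (by simp)) hu
  rw [mfderivWithin_eq_fderivWithin] at h1
  have h2 := mfderivWithin_extChartAt_symm_comp_mfderiv_extChartAt' (I := 𝓡 (2 * n)) hvz
  rw [ModelWithCorners.range_eq_univ, mfderivWithin_univ] at h2
  have h3 := congrArg (fun L => L y) h1
  have h4 := congrArg (fun L => L (mfderivWithin 𝓘(ℝ, ℝ × ℝ) (𝓡 (2 * n)) v strip z y)) h2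
  exact h4.symm.trans (congrArg (fun u : Model n =>
    (mfderiv 𝓘(ℝ, Model n) (𝓡 (2 * n)) (extChartAt (𝓡 (2 * n)) x₀).symm
      (extChartAt (𝓡 (2 * n)) x₀ (v z)) u : Model n)) h3.symm)

end

/-! ### The area density of a holomorphic strip -/

section

variable {n : ℕ} {M : Type*} [TopologicalSpace M] [ChartedSpace (Model n) M]

theorem continuousWithinAt_twoForm_apply {X : Type*} [TopologicalSpace X] {s : Set X} {x : X}
    {α : X → Model n [⋀^Fin 2]→L[ℝ] ℝ} {a b : X → Model n} (hα : ContinuousWithinAt α s x)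
    (ha : ContinuousWithinAt a s x) (hb : ContinuousWithinAt b s x) :
    ContinuousWithinAt (fun y => α y ![a y, b y]) s x := by
  have h1 : ContinuousWithinAt (fun y => (α y).toContinuousMultilinearMap) s x :=
    (ContinuousAlternatingMap.isEmbedding_toContinuousMultilinearMap.continuous.continuousAt
      ).comp_continuousWithinAt hα
  have h2 : ContinuousWithinAt (fun y => ![a y, b y]) s x := by
    rw [continuousWithinAt_pi]
    intro i
    fin_cases i
    · exact ha
    · exact hb
  exact h1.eval h2

theorem TwoForm.map_neg_right (Ω : TwoForm n M) (x : M) (a b : TangentSpace (𝓡 (2 * n)) x) :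
    Ω x ![a, -b] = Ω x ![b, a] := by
  have h1 : ![a, -b] = Function.update ![a, b] 1 (-b) := by
    ext i; fin_cases i <;> rfl
  have h2 : ![a, b] = ![b, a] ∘ Equiv.swap 0 1 := by
    ext i; fin_cases i <;> rfl
  have h3 := (Ω x).toAlternatingMap.map_update_neg ![a, b] 1 b
  have h4 := (Ω x).toAlternatingMap.map_swap ![b, a] (show (0 : Fin 2) ≠ 1 by decide)
  have h5 : Function.update ![a, b] 1 b = ![a, b] := Function.update_eq_self 1 ![a, b]
  rw [← h1, h5, h2, h4, neg_neg] at h3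
  exact h3

variable {J : EndField n M} {L₀ L₁ : Set M} {v : ℝ × ℝ → M}

theorem IsHolomorphicStrip.dTau_eq (hv : IsHolomorphicStrip J L₀ L₁ v) {z : ℝ × ℝ}
    (hz : z ∈ strip) : dTau (n := n) v z = -J (v z) (dT v z) :=
  eq_neg_of_add_eq_zero_left (hv.cauchyRiemann z hz)

variable [IsManifold (𝓡 (2 * n)) ∞ M]

/-- Smoothness of `Ω` is given in charts, so the density is computed in the chart at `v z₀`. It
provides the measurability behind integrability. -/
theorem IsSymplecticForm.continuousOn_areaDensity {Ω : TwoForm n M} (hΩ : IsSymplecticForm Ω)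
    {v : ℝ × ℝ → M} (hv : ContMDiffOn 𝓘(ℝ, ℝ × ℝ) (𝓡 (2 * n)) ∞ v strip) :
    ContinuousOn (areaDensity Ω v) strip := by
  intro z₀ hz₀
  set x₀ := v z₀
  set ψ := extChartAt (𝓡 (2 * n)) x₀
  have hψs : ContMDiffAt (𝓡 (2 * n)) 𝓘(ℝ, Model n) ∞ ψ x₀ := contMDiffAt_extChartAt
  have hf : ContDiffWithinAt ℝ ∞ (ψ ∘ v) strip z₀ :=
    (hψs.comp_contMDiffWithinAt z₀ (hv z₀ hz₀)).contDiffWithinAt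
  have hfd : ContinuousWithinAt (fun z => fderivWithin ℝ (ψ ∘ v) strip z) strip z₀ :=
    (hf.fderivWithin_right (m := 0) uniqueDiffOn_strip (by simp) hz₀).continuousWithinAt
  have hω : ContinuousWithinAt (fun z => Ω.inChart x₀ (ψ (v z))) strip z₀ := by
    have h1 : ContinuousAt (Ω.inChart x₀) (ψ (v z₀)) :=
      ((hΩ.smooth x₀).continuousOn).continuousAt
        ((isOpen_extChartAt_target x₀).mem_nhds (mem_extChartAt_target x₀))
    exact ContinuousAt.comp_continuousWithinAt (f := ψ ∘ v) h1 hf.continuousWithinAt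
  have hmain := continuousWithinAt_twoForm_apply hω
    (hfd.clm_apply (continuousWithinAt_const (b := ((1 : ℝ), (0 : ℝ)))))
    (hfd.clm_apply (continuousWithinAt_const (b := ((0 : ℝ), (1 : ℝ)))))
  have hsrc : ∀ᶠ z in 𝓝[strip] z₀, v z ∈ ψ.source :=
    (hv z₀ hz₀).continuousWithinAt.eventually_mem (extChartAt_source_mem_nhds x₀)
  have heq : ∀ z ∈ strip, v z ∈ ψ.source → areaDensity Ω v z =
      Ω.inChart x₀ (ψ (v z)) ![fderivWithin ℝ (ψ ∘ v) strip z (1, 0),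
        fderivWithin ℝ (ψ ∘ v) strip z (0, 1)] := by
    intro z hz hvz
    have e1 := mfderivWithin_strip_eq hv x₀ hz hvz (1, 0)
    have e2 := mfderivWithin_strip_eq hv x₀ hz hvz (0, 1)
    have e3 : areaDensity Ω v z = Ω (ψ.symm (ψ (v z)))
        ![(mfderivWithin 𝓘(ℝ, ℝ × ℝ) (𝓡 (2 * n)) v strip z ((1, 0) : ℝ × ℝ) : Model n),
          (mfderivWithin 𝓘(ℝ, ℝ × ℝ) (𝓡 (2 * n)) v strip z ((0, 1) : ℝ × ℝ) : Model n)] :=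
      Ω.congr_point (ψ.left_inv hvz).symm _ _
    rw [e3, e1, e2, TwoForm.inChart]
    refine congrArg (Ω (ψ.symm (ψ (v z)))) ?_
    funext i
    fin_cases i <;> rfl
  refine hmain.congr_of_eventuallyEq ?_ (heq z₀ hz₀ (mem_extChartAt_source x₀))
  filter_upwards [hsrc, self_mem_nhdsWithin] with z h1 h2 using heq z h2 h1

namespace IsHolomorphicStrip

theorem J_dTau (hv : IsHolomorphicStrip J L₀ L₁ v) {Ω : TwoForm n M} (hJ : IsCompatible Ω J)
    {z : ℝ × ℝ} (hz : z ∈ strip) : J (v z) (dTau v z) = dT v z := by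
  rw [hv.dTau_eq hz, map_neg, hJ.sq, neg_neg]

theorem areaDensity_eq_dTau (hv : IsHolomorphicStrip J L₀ L₁ v) {Ω : TwoForm n M}
    (hJ : IsCompatible Ω J) {z : ℝ × ℝ} (hz : z ∈ strip) :
    Ω (v z) ![dTau v z, J (v z) (dTau v z)] = areaDensity Ω v z := by
  rw [hv.J_dTau hJ hz, areaDensity]

theorem areaDensity_eq_dT (hv : IsHolomorphicStrip J L₀ L₁ v) {Ω : TwoForm n M}
    (hJ : IsCompatible Ω J) {z : ℝ × ℝ} (hz : z ∈ strip) :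
    Ω (v z) ![dT v z, J (v z) (dT v z)] = areaDensity Ω v z := by
  have h : J (v z) (dT v z) = -dTau v z := by rw [← hv.J_dTau hJ hz, hJ.sq]
  rw [h, TwoForm.map_neg_right, areaDensity]

theorem areaDensity_nonneg (hv : IsHolomorphicStrip J L₀ L₁ v) {Ω : TwoForm n M}
    (hJ : IsCompatible Ω J) {z : ℝ × ℝ} (hz : z ∈ strip) : 0 ≤ areaDensity Ω v z := by
  rw [← hv.areaDensity_eq_dTau hJ hz]
  by_cases h : dTau (n := n) v z = 0
  · rw [h]
    exact ((Ω (v z)).map_coord_zero 0 rfl).ge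
  · exact (hJ.pos _ _ h).le

/-- By the Cauchy–Riemann equation both terms of the energy density equal the nonnegative area
density. -/
theorem integrableOn_areaDensity (hv : IsHolomorphicStrip J L₀ L₁ v) {Ω : TwoForm n M}
    (hΩ : IsSymplecticForm Ω) (hJ : IsCompatible Ω J) (hE : energy Ω J v < ⊤) :
    IntegrableOn (areaDensity Ω v) strip := by
  refine ⟨(hΩ.continuousOn_areaDensity hv.smooth).aestronglyMeasurable measurableSet_strip, ?_⟩
  rw [hasFiniteIntegral_iff_ofReal ((ae_restrict_mem measurableSet_strip).mono fun z hz =>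
    hv.areaDensity_nonneg hJ hz)]
  have h1 : ∫⁻ z in strip, ENNReal.ofReal (areaDensity Ω v z) ≤
      ∫⁻ z in strip, ENNReal.ofReal
        (Ω (v z) ![dTau v z, J (v z) (dTau v z)] + Ω (v z) ![dT v z, J (v z) (dT v z)]) := by
    refine setLIntegral_mono' measurableSet_strip fun z hz => ENNReal.ofReal_le_ofReal ?_
    rw [hv.areaDensity_eq_dTau hJ hz, hv.areaDensity_eq_dT hJ hz]
    linarith [hv.areaDensity_nonneg hJ hz]
  refine h1.trans_lt ?_
  rw [energy] at hE
  by_contra h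
  rw [not_lt, top_le_iff] at h
  rw [h, ENNReal.mul_top (by simp)] at hE
  exact lt_irrefl _ hE

end IsHolomorphicStrip

end

/-! ### Lifting the strip through the Darboux embedding -/

section

variable {n : ℕ} {M : Type*}

/-- The part of the strip which `v` maps to the image of the open ball. -/
def ballDomain (e : Cn n → M) (r : ℝ) (v : ℝ × ℝ → M) : Set (ℝ × ℝ) :=
  {z | z ∈ strip ∧ v z ∈ e '' Metric.ball 0 r}

/-- The expression of `v` in the Darboux chart `e⁻¹`. -/
noncomputable def ballLift (e : Cn n → M) (r : ℝ) (v : ℝ × ℝ → M) (z : ℝ × ℝ) : Cn n :=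
  Function.invFunOn e (Metric.ball 0 r) (v z)

section Lift

variable {e : Cn n → M} {r : ℝ} {v : ℝ × ℝ → M} {z : ℝ × ℝ}

theorem ballLift_mem (hz : z ∈ ballDomain e r v) : ballLift e r v z ∈ Metric.ball (0 : Cn n) r :=
  Function.invFunOn_mem hz.2

theorem apply_ballLift (hz : z ∈ ballDomain e r v) : e (ballLift e r v z) = v z :=
  Function.invFunOn_eq hz.2

theorem ballLift_mem_closedBall (hz : z ∈ ballDomain e r v) :
    ballLift e r v z ∈ Metric.closedBall (0 : Cn n) r :=
  Metric.ball_subset_closedBall (ballLift_mem hz)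

theorem ballLift_eq (he : InjOn e (Metric.closedBall 0 r)) (hz : z ∈ strip) {ζ : Cn n}
    (hζ : ζ ∈ Metric.ball (0 : Cn n) r) (h : e ζ = v z) :
    z ∈ ballDomain e r v ∧ ballLift e r v z = ζ := by
  have hzD : z ∈ ballDomain e r v := ⟨hz, ζ, hζ, h⟩
  exact ⟨hzD, he (ballLift_mem_closedBall hzD) (Metric.ball_subset_closedBall hζ)
    ((apply_ballLift hzD).trans h.symm)⟩

end Lift

variable [TopologicalSpace M] [ChartedSpace (Model n) M] [IsManifold (𝓡 (2 * n)) ∞ M]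

section Derivative

variable {Ω : TwoForm n M} {e : Cn n → M} {r : ℝ} {v : ℝ × ℝ → M} {z : ℝ × ℝ}

/-- Injectivity of `e` identifies the set-theoretic lift near `z` with `G ∘ v` for a smooth local
inverse `G`. -/
theorem IsSymplecticEmbedding.ballLift_smooth (he : IsSymplecticEmbedding Ω e r)
    (hv : ContMDiffOn 𝓘(ℝ, ℝ × ℝ) (𝓡 (2 * n)) ∞ v strip) (hz : z ∈ ballDomain e r v) :
    ballDomain e r v ∈ 𝓝[strip] z ∧ ContDiffWithinAt ℝ ∞ (ballLift e r v) strip z := by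
  obtain ⟨G, hG0, hGs, hGe⟩ := he.exists_local_inverse (mem_ball_zero_iff.1 (ballLift_mem hz))
  rw [apply_ballLift hz] at hG0 hGs hGe
  have hvc := (hv z hz.1).continuousWithinAt
  have h1 : ∀ᶠ y in 𝓝[strip] z, G (v y) ∈ Metric.ball (0 : Cn n) r := by
    refine (hGs.continuousAt.comp_continuousWithinAt hvc).eventually_mem ?_
    refine Metric.isOpen_ball.mem_nhds ?_
    rw [Function.comp_apply, hG0]
    exact ballLift_mem hz
  have h2 : ∀ᶠ y in 𝓝[strip] z, y ∈ ballDomain e r v ∧ ballLift e r v y = G (v y) := by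
    filter_upwards [h1, hvc.eventually hGe, self_mem_nhdsWithin] with y hy1 hy2 hy3
    exact ballLift_eq he.injOn hy3 hy1 hy2
  refine ⟨h2.mono fun y hy => hy.1, ?_⟩
  have h3 : ContDiffWithinAt ℝ ∞ (G ∘ v) strip z :=
    (hGs.comp_contMDiffWithinAt z (hv z hz.1)).contDiffWithinAt
  exact h3.congr_of_eventuallyEq (h2.mono fun y hy => hy.2) hG0.symm

theorem IsSymplecticEmbedding.mfderivWithin_strip (he : IsSymplecticEmbedding Ω e r)
    (hv : ContMDiffOn 𝓘(ℝ, ℝ × ℝ) (𝓡 (2 * n)) ∞ v strip) (hz : z ∈ ballDomain e r v)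
    (y : ℝ × ℝ) : (mfderivWithin 𝓘(ℝ, ℝ × ℝ) (𝓡 (2 * n)) v strip z y : Model n) =
      ballDeriv e r (ballLift e r v z) (fderivWithin ℝ (ballLift e r v) strip z y) := by
  obtain ⟨hD, hs⟩ := he.ballLift_smooth hv hz
  have hnhds : Metric.closedBall (0 : Cn n) r ∈ 𝓝 (ballLift e r v z) :=
    Metric.closedBall_mem_nhds_of_mem (ballLift_mem hz)
  have hes : ContMDiffAt 𝓘(ℝ, Cn n) (𝓡 (2 * n)) ∞ e (ballLift e r v z) :=
    he.smooth.contMDiffAt hnhds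
  have h1 : mfderivWithin 𝓘(ℝ, ℝ × ℝ) (𝓡 (2 * n)) (e ∘ ballLift e r v) strip z =
      (mfderiv 𝓘(ℝ, Cn n) (𝓡 (2 * n)) e (ballLift e r v z)).comp
        (mfderivWithin 𝓘(ℝ, ℝ × ℝ) 𝓘(ℝ, Cn n) (ballLift e r v) strip z) :=
    mfderiv_comp_mfderivWithin z (hes.mdifferentiableAt (by simp))
      (hs.contMDiffWithinAt.mdifferentiableWithinAt (by simp)) (uniqueMDiffWithinAt_strip hz.1)
  rw [mfderivWithin_eq_fderivWithin, ← mfderivWithin_of_mem_nhds hnhds] at h1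
  have h2 : v =ᶠ[𝓝[strip] z] e ∘ ballLift e r v := by
    filter_upwards [hD] with y hy using (apply_ballLift hy).symm
  have h3 := h2.mfderivWithin_eq (I := 𝓘(ℝ, ℝ × ℝ)) (I' := 𝓡 (2 * n)) (apply_ballLift hz).symm
  have h4 : (mfderivWithin 𝓘(ℝ, ℝ × ℝ) (𝓡 (2 * n)) v strip z y : Model n) =
      mfderivWithin 𝓘(ℝ, ℝ × ℝ) (𝓡 (2 * n)) (e ∘ ballLift e r v) strip z y := by
    rw [h3]
    rfl
  exact h4.trans (congrArg (fun L : ℝ × ℝ →L[ℝ] Model n => L y) h1)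

end Derivative

section Adapted

variable {Ω : TwoForm n M} {U L : Set M} {e : Cn n → M} {r : ℝ} {J : EndField n M}
  {L₁ : Set M} {v : ℝ × ℝ → M}

theorem IsAdaptedPair.cauchyRiemann (ha : IsAdaptedPair Ω U L e r J)
    (hv : IsHolomorphicStrip J L L₁ v) {z : ℝ × ℝ} (hz : z ∈ ballDomain e r v) :
    fderivWithin ℝ (ballLift e r v) strip z (0, 1) =
      Complex.I • fderivWithin ℝ (ballLift e r v) strip z (1, 0) := by
  have h1 := ha.embedding.mfderivWithin_strip hv.smooth hz (1, 0)
  have h2 := ha.embedding.mfderivWithin_strip hv.smooth hz (0, 1)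
  set a := fderivWithin ℝ (ballLift e r v) strip z (1, 0)
  set b := fderivWithin ℝ (ballLift e r v) strip z (0, 1)
  have hζ := ballLift_mem_closedBall hz
  have h3 : (J (v z) (dTau v z) : Model n) = dT v z := hv.J_dTau ha.compatible hz.1
  have h4 : (J (v z) (dTau v z) : Model n) = J (e (ballLift e r v z)) (dTau (n := n) v z) :=
    J.congr_point (apply_ballLift hz).symm _
  have h5 : (J (e (ballLift e r v z)) (dTau (n := n) v z) : Model n) =
      ballDeriv e r (ballLift e r v z) (Complex.I • a) := by
    rw [← ha.pushforward _ hζ a]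
    exact congrArg (fun u : Model n => (J (e (ballLift e r v z)) u : Model n)) h1
  exact ha.embedding.ballDeriv_injective hζ
    (h2.symm.trans (h3.symm.trans (h4.trans h5)))

/-- Pulling `Ω` back by `e` turns the density into `ω₀(a, i a) = |a|²` with `a = ∂_τ w`. -/
theorem IsAdaptedPair.areaDensity_eq (ha : IsAdaptedPair Ω U L e r J)
    (hv : IsHolomorphicStrip J L L₁ v) {z : ℝ × ℝ} (hz : z ∈ ballDomain e r v) :
    areaDensity Ω v z = ‖tauDeriv (ballLift e r v) z‖ ^ 2 := by
  have h1 := ha.embedding.mfderivWithin_strip hv.smooth hz (1, 0)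
  have h2 := ha.embedding.mfderivWithin_strip hv.smooth hz (0, 1)
  rw [ha.cauchyRiemann hv hz] at h2
  have hζ := ballLift_mem_closedBall hz
  have h3 := ha.embedding.pullback _ hζ (tauDeriv (ballLift e r v) z)
    (Complex.I • tauDeriv (ballLift e r v) z)
  rw [stdForm_I_smul] at h3
  rw [← h3]
  refine (Ω.congr_point (apply_ballLift hz).symm _ _).trans ?_
  refine congrArg (Ω (e (ballLift e r v z))) ?_
  funext i
  fin_cases i
  · exact h1
  · exact h2

theorem IsAdaptedPair.isHolomorphicPiece [T2Space M] (ha : IsAdaptedPair Ω U L e r J)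
    (hv : IsHolomorphicStrip J L L₁ v) (hdisj : U ∩ L₁ = ∅) :
    IsHolomorphicPiece (ballDomain e r v) (ballLift e r v) r where
  subset _ hz := hz.1
  mem_nhds _ hz := (ha.embedding.ballLift_smooth hv.smooth hz).1
  contDiff _ hz := (ha.embedding.ballLift_smooth hv.smooth hz).2
  cauchyRiemann _ hz := ha.cauchyRiemann hv hz
  real τ hz := by
    refine (ha.preimage _ (ballLift_mem_closedBall hz)).1 ?_
    rw [apply_ballLift hz]
    exact hv.bottom τ
  top τ hz := by
    have hU : v (τ, 1) ∈ U := ha.subset (image_mono Metric.ball_subset_closedBall hz.2)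
    exact (hdisj ▸ ⟨hU, hv.top τ⟩ : v (τ, 1) ∈ (∅ : Set M))
  isClosed s hs := by
    -- Properness: the sublevel set is the preimage under `v` of a compact, hence closed, subset of
    -- the Hausdorff space `M`.
    have h1 : IsCompact (e '' Metric.closedBall (0 : Cn n) s) :=
      (isCompact_closedBall 0 s).image_of_continuousOn
        (ha.embedding.smooth.continuousOn.mono (Metric.closedBall_subset_closedBall hs.le))
    have h2 := hv.smooth.continuousOn.preimage_isClosed_of_isClosed isClosed_strip h1.isClosed
    convert h2 using 1
    ext z
    constructor
    · rintro ⟨hz, hzs⟩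
      exact ⟨hz.1, _, mem_closedBall_zero_iff.2 hzs, apply_ballLift hz⟩
    · rintro ⟨hz, ζ, hζ, h⟩
      obtain ⟨h3, h4⟩ := ballLift_eq ha.embedding.injOn hz
        (Metric.closedBall_subset_ball hs hζ) h
      exact ⟨h3, by rw [h4]; exact mem_closedBall_zero_iff.1 hζ⟩

end Adapted

end

end Strip

/-! ### The area estimate for the strip -/

theorem mainTheorem5 {n : ℕ} {M : Type*} [TopologicalSpace M] [T2Space M]
    [SecondCountableTopology M] [ChartedSpace (Strip.Model n) M] [IsManifold (𝓡 (2 * n)) ∞ M]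
    (Ω : Strip.TwoForm n M) (hΩ : Strip.IsSymplecticForm Ω)
    (L : Set M) (hLcompact : IsCompact L) (hL : Strip.IsLagrangian Ω L)
    (U : Set M) (hU : IsOpen U)
    (H : ℝ → M → ℝ) (hH : Strip.IsHamiltonian (n := n) H)
    (φ : ℝ → M → M) (hφ : Strip.IsHamiltonianFlow Ω H φ)
    (hLU : (L ∩ U).Nonempty) (hdisj : U ∩ φ 1 '' L = ∅)
    (e : Strip.Cn n → M) (r : ℝ) (hr : 0 < r) (J₀ : Strip.EndField n M)
    (hadapted : Strip.IsAdaptedPair Ω U L e r J₀)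
    (v : ℝ × ℝ → M) (hv : Strip.IsHolomorphicStrip J₀ L (φ 1 '' L) v)
    (henergy : Strip.energy Ω J₀ v < ⊤) (hv0 : v (0, 0) = e 0) :
    IntegrableOn (Strip.areaDensity Ω v) Strip.strip ∧
      Real.pi * r ^ 2 / 2 ≤ ∫ z in Strip.strip, Strip.areaDensity Ω v z := by
  have hint := hv.integrableOn_areaDensity hΩ hadapted.compatible henergy
  refine ⟨hint, ?_⟩
  have hpiece := hadapted.isHolomorphicPiece hv hdisj
  obtain ⟨h0, hw0⟩ := Strip.ballLift_eq (v := v) hadapted.embedding.injOn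
    (z := (0, 0)) (by simp [Strip.strip]) (Metric.mem_ball_self hr) hv0.symm
  have heq := fun z hz => hadapted.areaDensity_eq hv (z := z) hz
  have hE := (hint.mono_set hpiece.subset).congr_fun heq hpiece.measurableSet
  calc Real.pi * r ^ 2 / 2
      ≤ ∫ z in Strip.ballDomain e r v, ‖Strip.tauDeriv (Strip.ballLift e r v) z‖ ^ 2 :=
        hpiece.area_ge hE hr h0 hw0
    _ = ∫ z in Strip.ballDomain e r v, Strip.areaDensity Ω v z :=
        (setIntegral_congr_fun hpiece.measurableSet heq).symm
    _ ≤ ∫ z in Strip.strip, Strip.areaDensity Ω v z :=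
        setIntegral_mono_set hint ((ae_restrict_mem Strip.measurableSet_strip).mono fun z hz =>
          hv.areaDensity_nonneg hadapted.compatible hz) hpiece.subset.eventuallyLE
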